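/- A \emph{web} in a closed disk $B$ is a finite oriented graph embedded in $B$ (multiple edges and closed circles without vertices are allowed) that meets $\partial B$ transversely in finitely many points, each lying on an edge, and all of whose vertices are trivalent and either sources or sinks. A closed web is such a graph in the sphere $S^2$, with no boundary points. A boundary point has sign $+$ if its edge points into $B$ and sign $-$ if its edge points out of $B$. Let $E$ be the set of edges (circles included) of a web $\Gamma$. Its web group is generated by the meridians $x_e$, $e\in E$, with one Wirtinger relator (a product of the three meridians) for each vertex. The representation variety $R(\Gamma)$ is the set of homomorphisms from the web group to $SU(3)$ that send each meridian to a matrix of trace $-1$. Such a matrix is determined by its $(+1)$-eigenspace, which is a line, and $R(\Gamma)$ is thereby regarded as a subset of $(\mathbb{CP}^2)^E$. Its components are its irreducible components, i.e. maximal irreducible subsets, in the real Zariski topology, whose closed sets are given by polynomials in the homogeneous coordinates and their complex conjugates. Let $\Gamma$ be a web in the disk with exactly four boundary points, numbered $1,2,3,4$ in the order in which they are met on the circle, with alternating signs $(+,-,+,-)$. Let $Ev_D:R(\Gamma)\to(\mathbb{CP}^2)^4$ be the evaluation map, taking a representation to the lines on the edges at the four boundary points, and let $$\Delta_v=\{(p,p,q,q)\mid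 p,q\in\mathbb{CP}^2\},\qquad \Delta_h=\{(p,q,q,p)\mid p,q\in\mathbb{CP}^2\}.$$ Let $\Gamma_v$ (respectively $\Gamma_h$) be the closed web obtained from $\Gamma$ by joining, with two disjoint arcs outside the disk, the boundary points $1$ and $2$, and $3$ and $4$ (respectively $2$ and $3$, and $4$ and $1$). Then for every component $C$ of $R(\Gamma)$: \begin{enumerate} \item $Ev_D(C)\subset\Delta_v$ or $Ev_D(C)\subset\Delta_h$. \item If $Ev_D(C)\subset\Delta_v$, then there are a component $C'$ of $R(\Gamma_v)$ and a diffeomorphism $\Phi:C\to C'$ that takes edge assignments to edge assignments: the line that $\Phi(\rho)$ assigns to the edge of $\Gamma_v$ containing an edge $e$ of $\Gamma$ is the line that $\rho$ assigns to $e$. \item If $Ev_D(C)\subset\Delta_h$, the same holds with $\Gamma_h$ in place of $\Gamma_v$. \end{enumerate} Here a diffeomorphism between (possibly singular) subsets of $(\mathbb{CP}^2)^E$ and $(\mathbb{CP}^2)^{E'}$ is a bijection such that it and its inverse are locally restrictions of smooth maps of the ambient real manifolds. -/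

import Mathlib

open scoped LinearAlgebra.Projectivization ContDiff Topology

noncomputable section

namespace PlanarWeb

/-! ### Orbit counting and planarity of combinatorial maps -/

/-- The number of classes of the equivalence relation generated by `r`. -/
def numClasses {D : Type} (r : D → D → Prop) : ℕ := Nat.card (Quot r)

/-- The number of cycles of a permutation, fixed points included. -/
def numCycles {D : Type} (π : Equiv.Perm D) : ℕ := numClasses fun x y => y = π x

/-- The number of orbits of the group generated by two permutations. -/
def numComponents {D : Type} (π ρ : Equiv.Perm D) : ℕ :=
  numClasses fun x y => y = π x ∨ y = ρ x

/-- A graph embedded in an oriented surface is encoded by its darts (half edges): `rot` sends a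
dart to the next one counterclockwise at the same vertex and `rev` sends it to the other half of
the same edge. Vertices, edges and faces are the cycles of `rot`, `rev` and `rot * rev`.
The embedding is planar iff all connected components have genus zero, that is, iff Euler's
formula `V - E + F = 2 C` holds, `C` being the number of connected components. -/
def EulerPlanar {D : Type} (rot rev : Equiv.Perm D) : Prop :=
  numCycles rot + numCycles (rot * rev) = numCycles rev + 2 * numComponents rot rev

/-- Relations generated by a permutation together with another relation. -/
def permRel {D : Type} (π : Equiv.Perm D) (r : D → D → Prop) (x y : D) : Prop := y = π x ∨ r x y

/-- A relation with one more related pair. -/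
def addPair {D : Type} (r : D → D → Prop) (a b x y : D) : Prop := r x y ∨ (x = a ∧ y = b)

theorem mk_perm {D : Type} (π : Equiv.Perm D) (r : D → D → Prop) (x : D) :
    Quot.mk (permRel π r) (π x) = Quot.mk (permRel π r) x :=
  (Quot.sound (show permRel π r x (π x) from Or.inl rfl)).symm

theorem numClasses_congr {D : Type} {r s : D → D → Prop}
    (h₁ : ∀ x y, r x y → Quot.mk s x = Quot.mk s y)
    (h₂ : ∀ x y, s x y → Quot.mk r x = Quot.mk r y) : numClasses r = numClasses s :=
  Nat.card_congr
    { toFun := Quot.lift (fun x => Quot.mk s x) h₁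
      invFun := Quot.lift (fun x => Quot.mk r x) h₂
      left_inv := by rintro ⟨x⟩; rfl
      right_inv := by rintro ⟨x⟩; rfl }

theorem numClasses_addPair_of_eq {D : Type} {r : D → D → Prop} {a b : D}
    (h : Quot.mk r a = Quot.mk r b) : numClasses r = numClasses (addPair r a b) :=
  numClasses_congr (fun x y hxy => Quot.sound (Or.inl hxy)) (by
    rintro x y (hxy | ⟨rfl, rfl⟩)
    · exact Quot.sound hxy
    · exact h)

open Classical in
theorem numClasses_addPair_of_ne {D : Type} [Finite D] {r : D → D → Prop} {a b : D}
    (h : Quot.mk r a ≠ Quot.mk r b) : numClasses r = numClasses (addPair r a b) + 1 := by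
  have e : {u : Quot r // u ≠ Quot.mk r b} ≃ Quot (addPair r a b) :=
    { toFun := fun u => Quot.lift (fun x => Quot.mk (addPair r a b) x)
        (fun x y hxy => Quot.sound (Or.inl hxy)) u.1
      invFun := Quot.lift (fun x => if hx : Quot.mk r x = Quot.mk r b then ⟨Quot.mk r a, h⟩
          else ⟨Quot.mk r x, hx⟩) (by
        rintro x y (hxy | ⟨rfl, rfl⟩)
        · have : Quot.mk r x = Quot.mk r y := Quot.sound hxy
          simp only [this]
        · simp [h])
      left_inv := by
        rintro ⟨⟨x⟩, hx⟩
        exact dif_neg hx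
      right_inv := by
        rintro ⟨x⟩
        by_cases hx : Quot.mk r x = Quot.mk r b
        · have h1 : Quot.mk (addPair r a b) a = Quot.mk (addPair r a b) b :=
            Quot.sound (Or.inr ⟨rfl, rfl⟩)
          have h2 := congrArg (Quot.lift (fun x => Quot.mk (addPair r a b) x)
            (fun x y hxy => Quot.sound (Or.inl hxy))) hx
          simp only [hx, dite_true]
          exact h1.trans h2.symm
        · simp only [hx, dite_false] }
  have h1 := Nat.card_congr e
  have : Fintype (Quot r) := Fintype.ofFinite _
  have h2 : Nat.card {u : Quot r // u ≠ Quot.mk r b} = Nat.card (Quot r) - 1 := by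
    rw [Nat.card_eq_fintype_card, Nat.card_eq_fintype_card, Fintype.card_subtype_compl,
      Fintype.card_subtype_eq]
  have h3 : 0 < Nat.card (Quot r) := by
    have : Nonempty (Quot r) := ⟨Quot.mk r a⟩
    exact Nat.card_pos
  unfold numClasses
  omega

theorem numClasses_swap_mul {D : Type} [DecidableEq D] (π : Equiv.Perm D) (r : D → D → Prop)
    (a b : D) : numClasses (addPair (permRel (Equiv.swap a b * π) r) a b) =
      numClasses (addPair (permRel π r) a b) := by
  have key : ∀ (s : D → D → Prop) (x : D), Quot.mk s a = Quot.mk s b →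
      Quot.mk s (Equiv.swap a b x) = Quot.mk s x := by
    intro s x h
    by_cases hxa : x = a
    · subst hxa; rw [Equiv.swap_apply_left]; exact h.symm
    by_cases hxb : x = b
    · subst hxb; rw [Equiv.swap_apply_right]; exact h
    rw [Equiv.swap_apply_of_ne_of_ne hxa hxb]
  apply numClasses_congr
  · rintro x y ((h | h) | h)
    · subst h
      rw [Equiv.Perm.mul_apply, key _ _ (Quot.sound (Or.inr ⟨rfl, rfl⟩))]
      exact Quot.sound (Or.inl (Or.inl rfl))
    · exact Quot.sound (Or.inl (Or.inr h))
    · exact Quot.sound (Or.inr h)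
  · rintro x y ((h | h) | h)
    · subst h
      rw [← key _ (π x) (Quot.sound (Or.inr ⟨rfl, rfl⟩))]
      exact Quot.sound (Or.inl (Or.inl rfl))
    · exact Quot.sound (Or.inl (Or.inr h))
    · exact Quot.sound (Or.inr h)

/-- Two points in different cycles of `π` lie in one cycle of `swap a b * π`. -/
theorem joined_swap_mul {D : Type} [Finite D] [DecidableEq D] (π : Equiv.Perm D) {a b : D}
    (h : Quot.mk (permRel π fun _ _ => False) a ≠ Quot.mk (permRel π fun _ _ => False) b) :
    Quot.mk (permRel (Equiv.swap a b * π) fun _ _ => False) a =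
      Quot.mk (permRel (Equiv.swap a b * π) fun _ _ => False) b := by
  set s := permRel (Equiv.swap a b * π) fun _ _ => False
  have hcyc : ∀ j : ℕ, Quot.mk (permRel π fun _ _ => False) ((π ^ j) b) =
      Quot.mk (permRel π fun _ _ => False) b := by
    intro j
    induction j with
    | zero => rfl
    | succ j ih =>
      rw [← ih, pow_succ', Equiv.Perm.mul_apply, mk_perm]
  have hs : ∀ j : ℕ, Quot.mk s ((π ^ j) b) = Quot.mk s b := by
    intro j
    induction j with
    | zero => rfl
    | succ j ih =>
      by_cases hb : (π ^ (j + 1)) b = b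
      · rw [hb]
      have ha : (π ^ (j + 1)) b ≠ a := by
        intro ha
        have := hcyc (j + 1)
        rw [ha] at this
        exact h this
      have h2 := mk_perm (Equiv.swap a b * π) (fun _ _ => False) ((π ^ j) b)
      rw [pow_succ', Equiv.Perm.mul_apply] at ha hb ⊢
      rw [Equiv.Perm.mul_apply, Equiv.swap_apply_of_ne_of_ne ha hb] at h2
      exact h2.trans ih
  have hlast : Quot.mk s a = Quot.mk s (π⁻¹ b) := by
    have h2 := mk_perm (Equiv.swap a b * π) (fun _ _ => False) (π⁻¹ b)
    simpa using h2
  rw [hlast, ← hs (orderOf π - 1)]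
  congr 1
  have h1 : π ^ (orderOf π - 1) * π = 1 := by
    rw [← pow_succ, Nat.sub_add_cancel (orderOf_pos π), pow_orderOf_eq_one]
  rw [eq_inv_of_mul_eq_one_left h1]

theorem numCycles_eq {D : Type} (π : Equiv.Perm D) :
    numCycles π = numClasses (permRel π fun _ _ => False) :=
  numClasses_congr (fun _ _ h => Quot.sound (Or.inl h)) (by
    rintro x y (h | h)
    · exact Quot.sound h
    · exact h.elim)

theorem numComponents_eq {D : Type} (π ρ : Equiv.Perm D) :
    numComponents π ρ = numClasses (permRel π fun x y => y = ρ x) := rfl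

/-- Points in one cycle of `π * ρ` lie in one orbit of the group generated by `π` and `ρ`. -/
theorem joined_of_face {D : Type} (π ρ : Equiv.Perm D) {a b : D}
    (h : Quot.mk (permRel (π * ρ) fun _ _ => False) a =
      Quot.mk (permRel (π * ρ) fun _ _ => False) b) :
    Quot.mk (permRel π fun x y => y = ρ x) a = Quot.mk (permRel π fun x y => y = ρ x) b := by
  refine congrArg (Quot.lift (fun x => Quot.mk (permRel π fun x y => y = ρ x) x) ?_) h
  rintro x y (h | h)
  · rw [h, Equiv.Perm.mul_apply]
    rw [mk_perm]
    exact Quot.sound (Or.inr rfl)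
  · exact h.elim

/-- The genus of a combinatorial map is nonnegative. -/
theorem euler_le {D : Type} [Fintype D] [DecidableEq D] (rev rot : Equiv.Perm D) :
    numCycles rot + numCycles (rot * rev) + numCycles rev ≤
      Fintype.card D + 2 * numComponents rot rev := by
  induction hn : rot.support.card using Nat.strong_induction_on generalizing rot with
  | _ n ih =>
  by_cases h1 : rot = 1
  · subst h1
    have e1 : numCycles (1 : Equiv.Perm D) ≤ Fintype.card D := by
      rw [← Nat.card_eq_fintype_card]
      exact Nat.card_le_card_of_surjective _ Quot.mk_surjective
    have e2 : numComponents (1 : Equiv.Perm D) rev = numCycles rev :=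
      numClasses_congr (by
        rintro x y (h | h)
        · rw [h]; rfl
        · exact Quot.sound h) (fun _ _ h => Quot.sound (Or.inr h))
    rw [one_mul, e2]
    omega
  obtain ⟨a, ha⟩ : ∃ a, rot a ≠ a := by
    by_contra hc
    push Not at hc
    exact h1 (Equiv.ext hc)
  set b := rot a with hb
  set rot' := Equiv.swap a b * rot with hrot'
  have hrot : rot = Equiv.swap a b * rot' := by
    rw [hrot', ← mul_assoc, Equiv.swap_mul_self, one_mul]
  have hfix : rot' a = a := by simp [hrot', ← hb]
  have hlt := Equiv.Perm.card_support_swap_mul ha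
  have IH := ih _ (hn ▸ hlt) rot' rfl
  -- cycles of the rotation
  have sepV : Quot.mk (permRel rot' fun _ _ => False) a ≠
      Quot.mk (permRel rot' fun _ _ => False) b := by
    intro hab
    have := congrArg (Quot.lift (fun x => x = a) (by
      rintro x y (h | h)
      · subst h
        have : rot' x = a ↔ x = a := by
          conv_lhs => rw [← hfix]
          exact rot'.injective.eq_iff
        exact propext this.symm
      · exact h.elim)) hab
    have h2 : b = a := by simpa using this
    exact ha h2
  have V1 := numClasses_addPair_of_ne sepV
  have V2 := numClasses_addPair_of_eq (joined_swap_mul rot' sepV)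
  rw [numClasses_swap_mul, ← hrot, ← numCycles_eq] at V2
  rw [← numCycles_eq] at V1
  -- faces
  have hface : rot * rev = Equiv.swap a b * (rot' * rev) := by rw [← mul_assoc, ← hrot]
  have F3 := numClasses_swap_mul (rot' * rev) (fun _ _ => False) a b
  rw [← hface] at F3
  have C3 := numClasses_swap_mul rot' (fun x y => y = rev x) a b
  rw [← hrot] at C3
  have joinC : Quot.mk (permRel rot fun x y => y = rev x) a =
      Quot.mk (permRel rot fun x y => y = rev x) b := Quot.sound (Or.inl hb)
  have C1 := numClasses_addPair_of_eq joinC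
  rw [← numComponents_eq] at C1
  by_cases hC : Quot.mk (permRel rot' fun x y => y = rev x) a =
      Quot.mk (permRel rot' fun x y => y = rev x) b
  · have C2 := numClasses_addPair_of_eq hC
    rw [← numComponents_eq] at C2
    have F1 : numCycles (rot * rev) ≤
        numClasses (addPair (permRel (rot * rev) fun _ _ => False) a b) + 1 := by
      rw [numCycles_eq]
      by_cases hF : Quot.mk (permRel (rot * rev) fun _ _ => False) a =
          Quot.mk (permRel (rot * rev) fun _ _ => False) b
      · have := numClasses_addPair_of_eq hF
        omega
      · have := numClasses_addPair_of_ne hF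
        omega
    have F2 : numClasses (addPair (permRel (rot' * rev) fun _ _ => False) a b) ≤
        numCycles (rot' * rev) := by
      rw [numCycles_eq]
      by_cases hF : Quot.mk (permRel (rot' * rev) fun _ _ => False) a =
          Quot.mk (permRel (rot' * rev) fun _ _ => False) b
      · have := numClasses_addPair_of_eq hF
        omega
      · have := numClasses_addPair_of_ne hF
        omega
    omega
  · have C2 := numClasses_addPair_of_ne hC
    rw [← numComponents_eq] at C2
    have sepF := fun h => hC (joined_of_face rot' rev h)
    have F1 := numClasses_addPair_of_ne sepF
    have F2 := numClasses_addPair_of_eq (joined_swap_mul (rot' * rev) sepF)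
    rw [← hface, ← numCycles_eq] at F2
    rw [← numCycles_eq] at F1
    omega

/-- Splitting a vertex of a planar map along two of its darts gives a planar map. -/
theorem EulerPlanar.swap_mul {D : Type} [Fintype D] [DecidableEq D] {rot rev : Equiv.Perm D}
    (h : EulerPlanar rot rev) (hrev : numCycles rev + numCycles rev = Fintype.card D) {a b : D}
    (hab : Quot.mk (permRel rot fun _ _ => False) a = Quot.mk (permRel rot fun _ _ => False) b)
    (hsep : Quot.mk (permRel (Equiv.swap a b * rot) fun _ _ => False) a ≠
      Quot.mk (permRel (Equiv.swap a b * rot) fun _ _ => False) b) :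
    EulerPlanar (Equiv.swap a b * rot) rev := by
  unfold EulerPlanar at h ⊢
  set rot' := Equiv.swap a b * rot with hrot'
  have hrot : rot = Equiv.swap a b * rot' := by
    rw [hrot', ← mul_assoc, Equiv.swap_mul_self, one_mul]
  have V1 := numClasses_addPair_of_eq hab
  have V2 := numClasses_addPair_of_ne hsep
  have V3 := numClasses_swap_mul rot (fun _ _ => False) a b
  rw [← hrot'] at V3
  rw [← numCycles_eq] at V1 V2
  have hface : rot * rev = Equiv.swap a b * (rot' * rev) := by rw [← mul_assoc, ← hrot]
  have F3 := numClasses_swap_mul (rot' * rev) (fun _ _ => False) a b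
  rw [← hface] at F3
  have C3 := numClasses_swap_mul rot' (fun x y => y = rev x) a b
  rw [← hrot] at C3
  have joinC : Quot.mk (permRel rot fun x y => y = rev x) a =
      Quot.mk (permRel rot fun x y => y = rev x) b := by
    refine congrArg (Quot.lift (fun x => Quot.mk (permRel rot fun x y => y = rev x) x) ?_) hab
    rintro x y (h | h)
    · exact Quot.sound (Or.inl h)
    · exact h.elim
  have C1 := numClasses_addPair_of_eq joinC
  rw [← numComponents_eq] at C1
  have E := euler_le rev rot'
  by_cases hC : Quot.mk (permRel rot' fun x y => y = rev x) a =
      Quot.mk (permRel rot' fun x y => y = rev x) b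
  · have C2 := numClasses_addPair_of_eq hC
    rw [← numComponents_eq] at C2
    have F2 : numClasses (addPair (permRel (rot' * rev) fun _ _ => False) a b) ≤
        numCycles (rot' * rev) := by
      rw [numCycles_eq]
      by_cases hF : Quot.mk (permRel (rot' * rev) fun _ _ => False) a =
          Quot.mk (permRel (rot' * rev) fun _ _ => False) b
      · have := numClasses_addPair_of_eq hF
        omega
      · have := numClasses_addPair_of_ne hF
        omega
    have F1 : numCycles (rot * rev) ≤
        numClasses (addPair (permRel (rot * rev) fun _ _ => False) a b) + 1 := by
      rw [numCycles_eq]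
      by_cases hF : Quot.mk (permRel (rot * rev) fun _ _ => False) a =
          Quot.mk (permRel (rot * rev) fun _ _ => False) b
      · have := numClasses_addPair_of_eq hF
        omega
      · have := numClasses_addPair_of_ne hF
        omega
    omega
  · have C2 := numClasses_addPair_of_ne hC
    rw [← numComponents_eq] at C2
    have sepF := fun h => hC (joined_of_face rot' rev h)
    have F1 := numClasses_addPair_of_ne sepF
    have F2 := numClasses_addPair_of_eq (joined_swap_mul (rot' * rev) sepF)
    rw [← hface, ← numCycles_eq] at F2
    rw [← numCycles_eq] at F1
    omega

/-- A fixed point free involution has half as many cycles as points. -/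
theorem numCycles_involution {D : Type} [Fintype D] [DecidableEq D] {rev : Equiv.Perm D}
    (h1 : ∀ d, rev (rev d) = d) (h2 : ∀ d, rev d ≠ d) :
    numCycles rev + numCycles rev = Fintype.card D := by
  classical
  have : Fintype (Quot fun x y => y = rev x) := Fintype.ofFinite _
  have hfib : ∀ q : Quot fun x y => y = rev x,
      (Finset.univ.filter fun d => (Quot.mk (fun x y => y = rev x) d) = q).card = 2 := by
    rintro ⟨x⟩
    have : (Finset.univ.filter fun d => (Quot.mk (fun x y => y = rev x) d) = Quot.mk _ x) =
        {x, rev x} := by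
      ext d
      simp only [Finset.mem_filter, Finset.mem_univ, true_and, Finset.mem_insert,
        Finset.mem_singleton]
      constructor
      · intro hd
        have := congrArg (Quot.lift (fun d => d = x ∨ d = rev x) (by
          rintro y z rfl
          apply propext
          constructor
          · rintro (rfl | rfl)
            · exact Or.inr rfl
            · exact Or.inl (h1 x)
          · rintro (h | h)
            · exact Or.inr (by rw [← h, h1])
            · exact Or.inl (rev.injective h))) hd
        simpa using this
      · rintro (rfl | rfl)
        · rfl
        · exact (Quot.sound (r := fun x y => y = rev x) rfl).symm
    rw [this, Finset.card_pair (h2 x).symm]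
  have := Finset.card_eq_sum_card_fiberwise (s := Finset.univ) (t := Finset.univ)
    (f := fun d : D => Quot.mk (fun x y => y = rev x) d) (fun _ _ => Finset.mem_univ _)
  simp only [hfib, Finset.sum_const, Finset.card_univ, smul_eq_mul] at this
  unfold numCycles numClasses
  rw [Nat.card_eq_fintype_card]
  omega

/-! ### Planar webs -/

/-- A planar web in a disk with `n` boundary points (a closed web in the sphere if `n = 0`).

The disk is collapsed along its boundary circle to a sphere, so that, for `n > 0`, the boundary
points become one extra vertex, whose darts `bdry 0, …, bdry (n - 1)` follow each other in the
order in which the boundary points are met on the circle. All other vertices are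
* trivalent vertices, which are sources or sinks, or
* bivalent vertices, where the orientation passes through: these are not vertices of the web, but
  marked points on its edges. They are what allows closed circles without vertices, and arcs that
  are glued end to end.

`out d` says that the edge containing the dart `d` is oriented away from the vertex of `d`. -/
structure Web (n : ℕ) where
  Dart : Type
  [fintypeDart : Fintype Dart]
  [decEqDart : DecidableEq Dart]
  /-- the next dart, counterclockwise, at the same vertex -/
  rot : Equiv.Perm Dart
  /-- the other half of the edge -/
  rev : Equiv.Perm Dart
  rev_rev : ∀ d, rev (rev d) = d
  rev_ne : ∀ d, rev d ≠ d
  out : Dart → Prop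
  out_rev : ∀ d, out (rev d) ↔ ¬ out d
  bdry : Fin n → Dart
  bdry_injective : Function.Injective bdry
  rot_bdry : ∀ i, rot (bdry i) = bdry (finRotate n i)
  interior : ∀ d, d ∉ Set.range bdry →
    (rot d ≠ d ∧ rot (rot d) = d ∧ (out (rot d) ↔ ¬ out d)) ∨
    (rot d ≠ d ∧ rot (rot (rot d)) = d ∧ (out (rot d) ↔ out d))
  planar : EulerPlanar rot rev

attribute [instance] Web.fintypeDart Web.decEqDart

namespace Web

variable {n : ℕ}

/-- `d` is a dart at a bivalent vertex, that is, at a marked point of an edge. -/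
def IsMarked (Γ : Web n) (d : Γ.Dart) : Prop := d ∉ Set.range Γ.bdry ∧ Γ.rot (Γ.rot d) = d

/-- `d` is a dart at a (trivalent) vertex of the web. -/
def IsTrivalent (Γ : Web n) (d : Γ.Dart) : Prop := d ∉ Set.range Γ.bdry ∧ Γ.rot (Γ.rot d) ≠ d

/-- The edges of the web: two halves of an edge of the underlying map belong to the same edge of
the web, and so do the two darts at a marked point. A circle is also an edge. -/
def Edge (Γ : Web n) : Type := Quot fun d d' : Γ.Dart => d' = Γ.rev d ∨ (Γ.IsMarked d ∧ d' = Γ.rot d)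

/-- The edge of the web that contains a dart. -/
def edge (Γ : Web n) (d : Γ.Dart) : Γ.Edge := Quot.mk _ d

instance (Γ : Web n) : Finite Γ.Edge := Finite.of_surjective Γ.edge Quot.mk_surjective

instance (Γ : Web n) : Fintype Γ.Edge := Fintype.ofFinite _

/-- The Wirtinger relators, one for each vertex (up to cyclic permutation): the product of the
meridians of the three edges, read clockwise at a sink and counterclockwise at a source. -/
def relators (Γ : Web n) : Set (FreeGroup Γ.Edge) :=
  {w | ∃ d, Γ.IsTrivalent d ∧
    ((¬ Γ.out d ∧ w = FreeGroup.of (Γ.edge (Γ.rot (Γ.rot d))) * FreeGroup.of (Γ.edge (Γ.rot d)) *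
        FreeGroup.of (Γ.edge d)) ∨
     (Γ.out d ∧ w = FreeGroup.of (Γ.edge d) * FreeGroup.of (Γ.edge (Γ.rot d)) *
        FreeGroup.of (Γ.edge (Γ.rot (Γ.rot d)))))}

/-- The fundamental group of the complement of the web, by its Wirtinger presentation. -/
abbrev Group (Γ : Web n) : Type := PresentedGroup Γ.relators

/-- The meridian of an edge. -/
def meridian (Γ : Web n) (e : Γ.Edge) : Γ.Group := PresentedGroup.of e

end Web

/-! ### Lines in complex three-space -/

/-- The complex projective plane. -/
abbrev CP2 : Type := ℙ ℂ (Fin 3 → ℂ)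

/-- `z` is a system of homogeneous coordinates of the family `x` of points of `CP2`. -/
def Represents {E : Type} (z : E → Fin 3 → ℂ) (x : E → CP2) : Prop :=
  ∀ e, ∃ h : z e ≠ 0, Projectivization.mk ℂ (z e) h = x e

/-- The real Zariski topology on `CP2 ^ E`: the closed sets are those cut out by polynomials in the
homogeneous coordinates of the points and their complex conjugates. -/
@[reducible] def zariski (E : Type) : TopologicalSpace (E → CP2) :=
  TopologicalSpace.generateFrom
    {U | ∃ p : MvPolynomial ((E × Fin 3) ⊕ (E × Fin 3)) ℂ,
      U = {x | ∃ z, Represents z x ∧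
        p.eval (Sum.elim (fun k => z k.1 k.2) fun k => starRingEnd ℂ (z k.1 k.2)) ≠ 0}}

/-- Smoothness of a map `f` from a subset `S` of the real manifold `CP2 ^ E` to `CP2 ^ F`: near each
point of `S` it is given, in homogeneous coordinates, by a smooth function on an open set. -/
def SmoothOn {E F : Type} [Fintype E] [Fintype F] (f : (E → CP2) → (F → CP2))
    (S : Set (E → CP2)) : Prop :=
  ∀ x ∈ S, ∀ z, Represents z x → ∃ U : Set (E → Fin 3 → ℂ), IsOpen U ∧ z ∈ U ∧
    ∃ G : (E → Fin 3 → ℂ) → (F → Fin 3 → ℂ), ContDiffOn ℝ ∞ G U ∧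
      ∀ w ∈ U, ∀ y ∈ S, Represents w y → Represents (G w) (f y)

/-- `f` restricts to a diffeomorphism between the (possibly singular) subsets `S` and `T`. -/
def IsDiffeoOn {E F : Type} [Fintype E] [Fintype F] (f : (E → CP2) → (F → CP2))
    (S : Set (E → CP2)) (T : Set (F → CP2)) : Prop :=
  Set.MapsTo f S T ∧ SmoothOn f S ∧
    ∃ g : (F → CP2) → (E → CP2), Set.MapsTo g T S ∧ SmoothOn g T ∧ Set.InvOn g f S T

/-- The subset `Δ_v` of `CP2 ^ 4`. -/
def diagV : Set (Fin 4 → CP2) := {x | ∃ u v : CP2, x = ![u, u, v, v]}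

/-- The subset `Δ_h` of `CP2 ^ 4`. -/
def diagH : Set (Fin 4 → CP2) := {x | ∃ u v : CP2, x = ![u, v, v, u]}

/-! ### Representation varieties -/

namespace Web

variable {n : ℕ}

/-- The representation variety `R(Γ)`: representations of the web group in `SU(3)` that send all
meridians to matrices of trace `-1`. Such a matrix is determined by the line that is its eigenspace
for the eigenvalue `1`, so that `R(Γ)` is a subset of `CP2 ^ E`. -/
def repVariety (Γ : Web n) : Set (Γ.Edge → CP2) :=
  {x | ∃ ρ : Γ.Group →* Matrix.specialUnitaryGroup (Fin 3) ℂ, ∀ e,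
    (ρ (Γ.meridian e)).1.trace = -1 ∧
    ∀ v : Fin 3 → ℂ, Matrix.mulVec (ρ (Γ.meridian e)).1 v = v ↔ v ∈ (x e).submodule}

/-- The irreducible components of `R(Γ)`, that is, its maximal irreducible subsets. -/
def components (Γ : Web n) : Set (Set (Γ.Edge → CP2)) :=
  {C | Maximal (fun s => s ⊆ Γ.repVariety ∧ @IsIrreducible _ (zariski Γ.Edge) s) C}

/-- The evaluation map, sending a representation to the lines on the edges at the boundary. -/
def evBoundary (Γ : Web n) (x : Γ.Edge → CP2) : Fin n → CP2 := fun i => x (Γ.edge (Γ.bdry i))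

/-! ### Closing up a web with four boundary points -/

/-- The signs of the boundary points alternate along the circle. The sign of the `i`-th boundary
point is `+` (the edge points into the disk) iff `Γ.out (Γ.bdry i)`. -/
def Alternating (Γ : Web 4) : Prop := ∀ i, Γ.out (Γ.bdry (i + 1)) ↔ ¬ Γ.out (Γ.bdry i)

theorem rot_bdry_four (Γ : Web 4) (i : Fin 4) : Γ.rot (Γ.bdry i) = Γ.bdry (i + 1) := by
  rw [Γ.rot_bdry]
  congr 1
  exact finRotate_apply i

/-- The rotation of the map in which the boundary vertex is split into two bivalent vertices, one
with the darts `bdry i`, `bdry (i + 1)`, the other with `bdry (i + 2)`, `bdry (i + 3)`. -/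
def closeRot (Γ : Web 4) (i : Fin 4) : Equiv.Perm Γ.Dart :=
  Equiv.swap (Γ.bdry i) (Γ.bdry (i + 2)) * Γ.rot

theorem closeRot_bdry (Γ : Web 4) (i : Fin 4) :
    Γ.closeRot i (Γ.bdry i) = Γ.bdry (i + 1) ∧ Γ.closeRot i (Γ.bdry (i + 1)) = Γ.bdry i ∧
    Γ.closeRot i (Γ.bdry (i + 2)) = Γ.bdry (i + 3) ∧
    Γ.closeRot i (Γ.bdry (i + 3)) = Γ.bdry (i + 2) := by
  have h := Γ.bdry_injective
  simp only [closeRot, Equiv.Perm.mul_apply, rot_bdry_four]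
  refine ⟨?_, ?_, ?_, ?_⟩
  · exact Equiv.swap_apply_of_ne_of_ne (h.ne (by fin_cases i <;> decide))
      (h.ne (by fin_cases i <;> decide))
  · rw [show i + 1 + 1 = i + 2 by fin_cases i <;> decide, Equiv.swap_apply_right]
  · rw [show i + 2 + 1 = i + 3 by fin_cases i <;> decide]
    exact Equiv.swap_apply_of_ne_of_ne (h.ne (by fin_cases i <;> decide))
      (h.ne (by fin_cases i <;> decide))
  · rw [show i + 3 + 1 = i by fin_cases i <;> decide, Equiv.swap_apply_left]

theorem rot_notMem_bdry (Γ : Web 4) {d : Γ.Dart} (hd : d ∉ Set.range Γ.bdry) :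
    Γ.rot d ∉ Set.range Γ.bdry := by
  rintro ⟨j, hj⟩
  refine hd ⟨j - 1, Γ.rot.injective ?_⟩
  rw [rot_bdry_four, ← hj, sub_add_cancel]

theorem closeRot_of_notMem (Γ : Web 4) (i : Fin 4) {d : Γ.Dart} (hd : d ∉ Set.range Γ.bdry) :
    Γ.closeRot i d = Γ.rot d := by
  have h := Γ.rot_notMem_bdry hd
  rw [closeRot, Equiv.Perm.mul_apply]
  exact Equiv.swap_apply_of_ne_of_ne (fun h' => h ⟨_, h'.symm⟩) (fun h' => h ⟨_, h'.symm⟩)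

theorem closeRot_planar (Γ : Web 4) (i : Fin 4) : EulerPlanar (Γ.closeRot i) Γ.rev := by
  have hb := Γ.closeRot_bdry i
  have hinj := Γ.bdry_injective
  refine Γ.planar.swap_mul (numCycles_involution Γ.rev_rev Γ.rev_ne) ?_ ?_
  · rw [← mk_perm Γ.rot, rot_bdry_four, ← mk_perm Γ.rot, rot_bdry_four]
    congr 2
    fin_cases i <;> decide
  · intro h
    have := congrArg (Quot.lift (fun d => d = Γ.bdry i ∨ d = Γ.bdry (i + 1)) (by
      rintro x y (hxy | hxy)
      · subst hxy
        apply propext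
        change _ ↔ Γ.closeRot i x = _ ∨ Γ.closeRot i x = _
        constructor
        · rintro (rfl | rfl)
          · exact Or.inr hb.1
          · exact Or.inl hb.2.1
        · rintro (h | h)
          · exact Or.inr ((Γ.closeRot i).injective (h.trans hb.2.1.symm))
          · exact Or.inl ((Γ.closeRot i).injective (h.trans hb.1.symm))
      · exact hxy.elim)) h
    simp only [true_or, hinj.eq_iff, eq_iff_iff, true_iff] at this
    revert this
    fin_cases i <;> decide

/-- The closed web obtained from a web with four alternating boundary points by joining, outside
the disk, the boundary points `i` and `i + 1` by an arc, and `i + 2` and `i + 3` by another. The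
boundary points become marked points of the edges of the closed web. -/
def closeUp (Γ : Web 4) (h : Γ.Alternating) (i : Fin 4) : Web 0 where
  Dart := Γ.Dart
  rot := Γ.closeRot i
  rev := Γ.rev
  rev_rev := Γ.rev_rev
  rev_ne := Γ.rev_ne
  out := Γ.out
  out_rev := Γ.out_rev
  bdry := Fin.elim0
  bdry_injective := fun a => a.elim0
  rot_bdry := fun a => a.elim0
  interior := by
    intro d _
    by_cases hd : d ∈ Set.range Γ.bdry
    · left
      obtain ⟨j, rfl⟩ := hd
      obtain ⟨h0, h1, h2, h3⟩ := Γ.closeRot_bdry i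
      have hinj := Γ.bdry_injective
      have a1 := h i
      have a2 := h (i + 2)
      rw [show i + 2 + 1 = i + 3 by fin_cases i <;> decide] at a2
      have hj : j = i ∨ j = i + 1 ∨ j = i + 2 ∨ j = i + 3 := by
        clear * -
        revert i j; decide
      rcases hj with rfl | rfl | rfl | rfl
      · rw [h0, h1]
        exact ⟨hinj.ne (by clear * -; revert j; decide), rfl, a1⟩
      · rw [h1, h0]
        exact ⟨hinj.ne (by fin_cases i <;> decide), rfl, by tauto⟩
      · rw [h2, h3]
        exact ⟨hinj.ne (by fin_cases i <;> decide), rfl, a2⟩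
      · rw [h3, h2]
        exact ⟨hinj.ne (by fin_cases i <;> decide), rfl, by tauto⟩
    · have hd1 := Γ.rot_notMem_bdry hd
      have hd2 := Γ.rot_notMem_bdry hd1
      rw [Γ.closeRot_of_notMem i hd, Γ.closeRot_of_notMem i hd1, Γ.closeRot_of_notMem i hd2]
      exact Γ.interior d hd
  planar := Γ.closeRot_planar i

/-- Every edge of `Γ` is contained in an edge of the closed web. -/
def toCloseUp (Γ : Web 4) (h : Γ.Alternating) (i : Fin 4) : Γ.Edge → (Γ.closeUp h i).Edge :=
  Quot.map (fun d => d) (by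
    rintro d d' (hd | ⟨⟨hd, hd2⟩, hd'⟩)
    · exact Or.inl hd
    · have e1 : Γ.closeRot i d = Γ.rot d := Γ.closeRot_of_notMem i hd
      have e2 : Γ.closeRot i (Γ.rot d) = Γ.rot (Γ.rot d) :=
        Γ.closeRot_of_notMem i (Γ.rot_notMem_bdry hd)
      refine Or.inr ⟨⟨fun h => h.choose.elim0, ?_⟩, ?_⟩
      · change Γ.closeRot i (Γ.closeRot i d) = d
        rw [e1, e2, hd2]
      · exact hd'.trans e1.symm)

/-- `Γ_v`: the boundary points `0, 1` are joined outside the disk, and so are `2, 3`. -/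
def closeV (Γ : Web 4) (h : Γ.Alternating) : Web 0 := Γ.closeUp h 0

/-- `Γ_h`: the boundary points `1, 2` are joined outside the disk, and so are `3, 0`. -/
def closeH (Γ : Web 4) (h : Γ.Alternating) : Web 0 := Γ.closeUp h 1

/-- The edge of `Γ_v` that contains a given edge of `Γ`. -/
def toCloseV (Γ : Web 4) (h : Γ.Alternating) : Γ.Edge → (Γ.closeV h).Edge := Γ.toCloseUp h 0

/-- The edge of `Γ_h` that contains a given edge of `Γ`. -/
def toCloseH (Γ : Web 4) (h : Γ.Alternating) : Γ.Edge → (Γ.closeH h).Edge := Γ.toCloseUp h 1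

end Web

end PlanarWeb

end

/-! Let `P_e` be the orthogonal projection onto the line of the edge `e`. A matrix of trace `-1` in
`SU(3)` is a Hermitian involution, hence the reflection `2 P_e - 1`. If three such matrices have
product `1`, their lines are pairwise orthogonal (`orthogonal_of_mul_eq_one`). Orthogonality allows
a deformation: `twist r P`, with eigenvalue `r ^ 2` on the line and `r⁻¹` on its complement,
satisfies the same vertex relation for every nonzero `r` (`twist_mul_twist_mul_twist`). The value `r
= -1` gives back the given representation.

In a planar map whose darts carry group elements, inverse on the two halves of an edge, triviality
of the cyclic products around all vertices but one forces triviality around the last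
(`trivHol_of_planar`). Applied to the collapsed boundary, this says that the alternating product of
the four boundary twists is `1` for every `r`. Two values of `r` already separate its coefficients
and give `P₀ - P₀P₁ = P₃ - P₃P₂` and `P₀ - P₁ = P₃ - P₂`. Hence either `x₀ = x₁` and `x₂ = x₃`, or
`x₀ = x₃` and `x₁ = x₂` (`eq_or_eq_of_twist`, `boundary_lines`).

Both alternatives are Zariski closed, so an irreducible component satisfies one of them throughout.
The closed web has the same vertex relators with some edges identified, so its representation
variety is the part of `R(Γ)` where the joined boundary lines agree. Pullback of edge assignments
makes this identification bicontinuous and smooth, which transports components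
(`exists_component_closeUp`). -/

namespace PlanarWeb

/-! ### Holonomy around the vertices of a planar map -/

section Holonomy

variable {D : Type} {H : Type*} [Group H]

/-- The cycle of a permutation that contains a given point. -/
abbrev cyc (π : Equiv.Perm D) (x : D) : Quot (permRel π fun _ _ => False) := Quot.mk _ x

/-- The component of a map that contains a given dart. -/
abbrev comp (π ρ : Equiv.Perm D) (x : D) : Quot (permRel π fun x y => y = ρ x) := Quot.mk _ x

theorem cyc_apply (π : Equiv.Perm D) (x : D) : cyc π (π x) = cyc π x := mk_perm π _ x

/-- A set invariant under a permutation contains every cycle that it meets. -/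
theorem mem_of_cyc_eq {π : Equiv.Perm D} {p : D → Prop} (hp : ∀ x, p (π x) ↔ p x) {x y : D}
    (h : cyc π x = cyc π y) (hx : p x) : p y := by
  have := congrArg (Quot.lift p (by
    rintro x y (h | h)
    · subst h; exact propext (hp x).symm
    · exact h.elim)) h
  exact this.mp hx

/-- The product of the values of `g` around the cycle of `d` is trivial. -/
def TrivHol (g : D → H) (π : Equiv.Perm D) (d : D) : Prop :=
  ∃ m : D → H, ∀ x, cyc π x = cyc π d → m (π x) = m x * g x

variable {g : D → H} {π : Equiv.Perm D}

theorem TrivHol.congr {d d' : D} (h : TrivHol g π d) (hd : cyc π d = cyc π d') :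
    TrivHol g π d' := by
  obtain ⟨m, hm⟩ := h
  exact ⟨m, fun x hx => hm x (hx.trans hd.symm)⟩

/-- The condition is invariant under left translation of the potential `m`. This freedom lets
potentials on two cycles be matched at chosen points. -/
theorem TrivHol.exists_normalized {d : D} (h : TrivHol g π d) (u : H) :
    ∃ m : D → H, m d = u ∧ ∀ x, cyc π x = cyc π d → m (π x) = m x * g x := by
  obtain ⟨m, hm⟩ := h
  refine ⟨fun x => u * (m d)⁻¹ * m x, by simp, fun x hx => ?_⟩
  simp only [hm x hx, mul_assoc]

/-! ### Cycles and holonomy under multiplication by a transposition -/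

variable [DecidableEq D] {a c : D}

theorem cyc_swap_mul_eq {d x : D} (ha : cyc π d ≠ cyc π a) (hc : cyc π d ≠ cyc π c)
    (hx : cyc π x = cyc π d) : Equiv.swap a c (π x) = π x := by
  refine Equiv.swap_apply_of_ne_of_ne ?_ ?_
  · rintro rfl
    exact ha (by rw [← hx, cyc_apply])
  · rintro rfl
    exact hc (by rw [← hx, cyc_apply])

/-- Cycles of `swap a c * π` avoiding `a` and `c` are cycles of `π`. -/
theorem cyc_swap_mul_iff {d x : D} (ha : cyc π d ≠ cyc π a) (hc : cyc π d ≠ cyc π c) :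
    cyc (Equiv.swap a c * π) x = cyc (Equiv.swap a c * π) d ↔ cyc π x = cyc π d := by
  have key : ∀ x, cyc π x = cyc π d ↔ cyc π ((Equiv.swap a c * π) x) = cyc π d := by
    intro x
    rw [Equiv.Perm.mul_apply]
    by_cases hxa : π x = a
    · rw [hxa, Equiv.swap_apply_left, ← cyc_apply π x, hxa]
      exact ⟨fun h => (ha h.symm).elim, fun h => (hc h.symm).elim⟩
    by_cases hxc : π x = c
    · rw [hxc, Equiv.swap_apply_right, ← cyc_apply π x, hxc]
      exact ⟨fun h => (hc h.symm).elim, fun h => (ha h.symm).elim⟩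
    rw [Equiv.swap_apply_of_ne_of_ne hxa hxc, cyc_apply]
  constructor
  · intro h
    exact mem_of_cyc_eq (p := fun x => cyc π x = cyc π d) (fun x => (key x).symm) h.symm rfl
  · intro h
    refine (mem_of_cyc_eq (π := π) (p := fun x => cyc π x = cyc π d ∧
      cyc (Equiv.swap a c * π) x = cyc (Equiv.swap a c * π) d) (fun x => ?_) h.symm
      ⟨rfl, rfl⟩).2
    rw [cyc_apply]
    refine and_congr_right fun hx => ?_
    rw [← cyc_apply (Equiv.swap a c * π) x, Equiv.Perm.mul_apply, cyc_swap_mul_eq ha hc hx]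

theorem trivHol_swap_mul_iff {d : D} (ha : cyc π d ≠ cyc π a) (hc : cyc π d ≠ cyc π c) :
    TrivHol g (Equiv.swap a c * π) d ↔ TrivHol g π d := by
  refine exists_congr fun m => forall_congr' fun x => ?_
  rw [cyc_swap_mul_iff ha hc]
  refine imp_congr_right fun hx => ?_
  rw [Equiv.Perm.mul_apply, cyc_swap_mul_eq ha hc hx]

/-- The cycle of `a` in `swap a c * π` is the union of those of `a` and `c` in `π`, if these are
distinct. -/
theorem cyc_merge_iff [Finite D] (h : cyc π a ≠ cyc π c) {x : D} :
    cyc (Equiv.swap a c * π) x = cyc (Equiv.swap a c * π) a ↔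
      cyc π x = cyc π a ∨ cyc π x = cyc π c := by
  constructor
  · intro hx
    by_contra hn
    push Not at hn
    have := (cyc_swap_mul_iff (x := a) hn.1 hn.2).mp hx.symm
    exact hn.1 this.symm
  · have hj : cyc (Equiv.swap a c * π) a = cyc (Equiv.swap a c * π) c := joined_swap_mul π h
    have key : ∀ y, cyc (Equiv.swap a c * π) (π y) = cyc (Equiv.swap a c * π) a ↔
        cyc (Equiv.swap a c * π) y = cyc (Equiv.swap a c * π) a := by
      intro y
      rw [← cyc_apply (Equiv.swap a c * π) y, Equiv.Perm.mul_apply]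
      by_cases hya : π y = a
      · rw [hya, Equiv.swap_apply_left, hj]
      by_cases hyc : π y = c
      · rw [hyc, Equiv.swap_apply_right, hj]
      rw [Equiv.swap_apply_of_ne_of_ne hya hyc]
    rintro (hx | hx)
    · exact mem_of_cyc_eq (p := fun y => cyc (Equiv.swap a c * π) y = _) key hx.symm rfl
    · exact mem_of_cyc_eq (p := fun y => cyc (Equiv.swap a c * π) y = _) key hx.symm hj.symm

/-- The merged cycle runs through one old cycle and then the other, so its product is the product of
the two. Potentials normalized to `1` at `a` and at `c` glue at the two places where the path
changes cycles. -/
theorem TrivHol.merge [Finite D] (h : cyc π a ≠ cyc π c) (ha : TrivHol g π a)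
    (hc : TrivHol g π c) : TrivHol g (Equiv.swap a c * π) a := by
  classical
  obtain ⟨m₁, h₁, hm₁⟩ := ha.exists_normalized 1
  obtain ⟨m₂, h₂, hm₂⟩ := hc.exists_normalized 1
  refine ⟨fun x => if cyc π x = cyc π a then m₁ x else m₂ x, fun x hx => ?_⟩
  rw [Equiv.Perm.mul_apply]
  rcases (cyc_merge_iff h).mp hx with hx | hx
  · simp only [hx, if_true, ← hm₁ x hx]
    by_cases hxa : π x = a
    · simp [hxa, h.symm, h₁, h₂]
    · have hxc : π x ≠ c := fun hxc => h (by rw [← hx, ← hxc, cyc_apply])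
      rw [Equiv.swap_apply_of_ne_of_ne hxa hxc, if_pos (by rw [cyc_apply, hx])]
  · simp only [hx, h.symm, if_false, ← hm₂ x hx]
    by_cases hxc : π x = c
    · simp [hxc, h₁, h₂]
    · have hxa : π x ≠ a := fun hxa => h (by rw [← hx, ← hxa, cyc_apply])
      rw [Equiv.swap_apply_of_ne_of_ne hxa hxc, if_neg (by rw [cyc_apply, hx]; exact h.symm)]

/-- If a product and one of its factors are trivial, so is the other factor. The potential of the
merged cycle agrees, along the cycle of `c`, with a potential of that cycle alone. It therefore has
the same value on entering at `c` and on leaving to `a`, and still works when the detour is cut out.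
-/
theorem TrivHol.of_merge_left [Finite D] (h : cyc π a ≠ cyc π c)
    (hac : TrivHol g (Equiv.swap a c * π) a) (hc : TrivHol g π c) : TrivHol g π a := by
  obtain ⟨m, hm⟩ := hac
  obtain ⟨m₂, h₂, hm₂⟩ := hc.exists_normalized (m c)
  have hcyc : ∀ j : ℕ, cyc π ((π ^ j) c) = cyc π c := by
    intro j
    induction j with
    | zero => rfl
    | succ j ih => rw [← ih, pow_succ', Equiv.Perm.mul_apply, cyc_apply]
  have hna : ∀ j : ℕ, (π ^ j) c ≠ a := fun j hj => h (by rw [← hj, hcyc])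
  have hpow : ∀ j : ℕ, m ((π ^ j) c) = m₂ ((π ^ j) c) := by
    intro j
    induction j with
    | zero => exact h₂.symm
    | succ j ih =>
      by_cases hb : (π ^ (j + 1)) c = c
      · rw [hb, h₂]
      have hna' := hna (j + 1)
      have h3 := hm ((π ^ j) c) ((cyc_merge_iff h).mpr (Or.inr (hcyc j)))
      have h4 := hm₂ _ (hcyc j)
      rw [pow_succ', Equiv.Perm.mul_apply] at hb hna' ⊢
      rw [Equiv.Perm.mul_apply, Equiv.swap_apply_of_ne_of_ne hna' hb] at h3
      rw [h3, h4, ih]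
  have hord : π ((π ^ (orderOf π - 1)) c) = c := by
    rw [← Equiv.Perm.mul_apply, ← pow_succ', Nat.sub_add_cancel (orderOf_pos π),
      pow_orderOf_eq_one, Equiv.Perm.one_apply]
  have hma : m a = m c := by
    have h3 := hm _ ((cyc_merge_iff h).mpr (Or.inr (hcyc (orderOf π - 1))))
    have h4 := hm₂ _ (hcyc (orderOf π - 1))
    rw [Equiv.Perm.mul_apply, hord, Equiv.swap_apply_right, hpow, ← h4, hord, h₂] at h3
    exact h3
  refine ⟨m, fun x hx => ?_⟩
  have h3 := hm x ((cyc_merge_iff h).mpr (Or.inl hx))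
  rw [← h3, Equiv.Perm.mul_apply]
  by_cases hxa : π x = a
  · rw [hxa, Equiv.swap_apply_left, hma]
  · have hxc : π x ≠ c := fun hxc => h (by rw [← hx, ← hxc, cyc_apply])
    rw [Equiv.swap_apply_of_ne_of_ne hxa hxc]

theorem TrivHol.of_merge_right [Finite D] (h : cyc π a ≠ cyc π c)
    (hac : TrivHol g (Equiv.swap a c * π) a) (ha : TrivHol g π a) : TrivHol g π c := by
  have hj : cyc (Equiv.swap a c * π) a = cyc (Equiv.swap a c * π) c := joined_swap_mul π h
  have := hac.congr hj
  rw [Equiv.swap_comm] at this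
  exact this.of_merge_left h.symm ha

/-! ### Holonomy in planar maps -/

/-- The holonomy of a vertex that is a loop `d, rev d` is trivial. -/
theorem trivHol_involution {rev : Equiv.Perm D} (h1 : ∀ d, rev (rev d) = d)
    (h2 : ∀ d, rev d ≠ d) (hg : ∀ d, g (rev d) = (g d)⁻¹) (d : D) : TrivHol g rev d := by
  refine ⟨fun x => if x = rev d then g d else 1, fun x hx => ?_⟩
  have : x = d ∨ x = rev d := by
    refine mem_of_cyc_eq (π := rev) (p := fun x => x = d ∨ x = rev d) (fun y => ?_) hx.symm
      (Or.inl rfl)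
    rw [rev.injective.eq_iff, or_comm]
    refine or_congr_right ⟨fun h => by rw [← h, h1], fun h => by rw [h, h1]⟩
  rcases this with rfl | rfl
  · simp [(h2 x).symm]
  · simp [h1, (h2 d).symm, hg]

/-- In a planar map with edges labelled by group elements, the holonomy around a vertex is trivial
if it is trivial around all other vertices of the same component. Here `φ` is the permutation whose
cycles are the faces, so that the vertices are the cycles of `φ * rev`. -/
theorem trivHol_of_planar {D : Type} [Fintype D] [DecidableEq D] {g : D → H}
    {rev : Equiv.Perm D} (h1 : ∀ d, rev (rev d) = d) (h2 : ∀ d, rev d ≠ d)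
    (hg : ∀ d, g (rev d) = (g d)⁻¹) (φ : Equiv.Perm D) (hφ : EulerPlanar φ rev) (d₀ : D)
    (hd₀ : ∀ d, comp φ rev d = comp φ rev d₀ → cyc (φ * rev) d ≠ cyc (φ * rev) d₀ →
      TrivHol g (φ * rev) d) : TrivHol g (φ * rev) d₀ := by
  -- Each step cuts one dart `a` off its face, making it a face of length one. When all faces have
  -- length one, the vertices are the cycles of `rev`, and labels on opposite halves cancel.
  induction hn : φ.support.card using Nat.strong_induction_on generalizing φ d₀ with
  | _ n ih =>
  by_cases hφ1 : φ = 1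
  · subst hφ1
    rw [one_mul]
    exact trivHol_involution h1 h2 hg d₀
  obtain ⟨a, ha⟩ : ∃ a, φ a ≠ a := by
    by_contra hc
    push Not at hc
    exact hφ1 (Equiv.ext hc)
  obtain ⟨c, hc⟩ : ∃ c, φ a = c := ⟨_, rfl⟩
  have hlt := Equiv.Perm.card_support_swap_mul ha
  rw [hc] at hlt ha
  obtain ⟨φ', hφ'⟩ : ∃ φ', φ' = Equiv.swap a c * φ := ⟨_, rfl⟩
  rw [← hφ', hn] at hlt
  have hfix : φ' a = a := by simp [hφ', hc]
  have hcycφ : cyc φ a = cyc φ c := by rw [← hc, cyc_apply]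
  have hsep : cyc φ' a ≠ cyc φ' c := fun h => ha <|
    mem_of_cyc_eq (p := fun x => x = a) (fun x => by
      conv_lhs => rw [← hfix]
      exact φ'.injective.eq_iff) h rfl
  have hplan : EulerPlanar φ' rev := by
    rw [hφ']
    refine hφ.swap_mul (numCycles_involution h1 h2) hcycφ ?_
    rw [← hφ']; exact hsep
  have IH := fun d => ih _ hlt φ' hplan d
  have hrot : φ' * rev = Equiv.swap a c * (φ * rev) := by rw [hφ', mul_assoc]
  have hrot' : φ * rev = Equiv.swap a c * (φ' * rev) := by
    rw [hrot, ← mul_assoc, Equiv.swap_mul_self, one_mul]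
  have hcomp : comp φ rev a = comp φ rev c := Quot.sound (Or.inl hc.symm)
  have hcomp' : ∀ {x y}, comp φ' rev x = comp φ' rev y → comp φ rev x = comp φ rev y := by
    intro x y h
    refine congrArg (Quot.lift (fun x => comp φ rev x) ?_) h
    rintro x y (h | h)
    · rw [h, hφ', Equiv.Perm.mul_apply]
      have : comp φ rev (φ x) = comp φ rev x := mk_perm φ _ x
      by_cases hxa : φ x = a
      · rw [hxa, Equiv.swap_apply_left, ← hcomp, ← this, hxa]
      by_cases hxc : φ x = c
      · rw [hxc, Equiv.swap_apply_right, hcomp, ← this, hxc]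
      rw [Equiv.swap_apply_of_ne_of_ne hxa hxc, this]
    · exact Quot.sound (Or.inr h)
  have hcc : ∀ {x y}, cyc (φ * rev) x = cyc (φ * rev) y → comp φ rev x = comp φ rev y :=
    fun h => joined_of_face φ rev h
  have hcc' : ∀ {x y}, cyc (φ' * rev) x = cyc (φ' * rev) y → comp φ' rev x = comp φ' rev y :=
    fun h => joined_of_face φ' rev h
  by_cases hV : cyc (φ * rev) a = cyc (φ * rev) c
  · -- the vertex is split, and so is the component
    have hC' : comp φ' rev a ≠ comp φ' rev c := by
      intro hC
      -- If the component stayed connected, the number of faces would grow by one and the number of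
      -- vertices would not drop, against Euler's formula for both maps.
      have F1 := numClasses_addPair_of_eq hcycφ
      have F2 := numClasses_addPair_of_ne hsep
      have F3 := numClasses_swap_mul φ (fun _ _ => False) a c
      rw [← hφ', ← F1, ← numCycles_eq] at F3
      rw [F3, ← numCycles_eq] at F2
      have C1 := numClasses_addPair_of_eq hcomp
      have C2 := numClasses_addPair_of_eq hC
      have C3 := numClasses_swap_mul φ (fun x y => y = rev x) a c
      rw [← hφ', ← C1, ← C2, ← numComponents_eq, ← numComponents_eq] at C3
      have V1 := numClasses_addPair_of_eq hV
      have V3 := numClasses_swap_mul (φ * rev) (fun _ _ => False) a c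
      rw [← hrot, ← V1, ← numCycles_eq] at V3
      have V2 : numCycles (φ * rev) ≤ numCycles (φ' * rev) := by
        rw [numCycles_eq (φ' * rev)]
        by_cases hF : cyc (φ' * rev) a = cyc (φ' * rev) c
        · have := numClasses_addPair_of_eq hF
          omega
        · have := numClasses_addPair_of_ne hF
          omega
      unfold EulerPlanar at hφ hplan
      omega
    have hV' : cyc (φ' * rev) a ≠ cyc (φ' * rev) c := fun h => hC' (hcc' h)
    have hmerge : ∀ {x}, cyc (φ * rev) x = cyc (φ * rev) a ↔
        cyc (φ' * rev) x = cyc (φ' * rev) a ∨ cyc (φ' * rev) x = cyc (φ' * rev) c := by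
      intro x; rw [hrot']; exact cyc_merge_iff hV'
    have hout : ∀ {d}, cyc (φ * rev) d ≠ cyc (φ * rev) a →
        (TrivHol g (φ' * rev) d ↔ TrivHol g (φ * rev) d) := by
      intro d hd
      rw [hrot]
      exact trivHol_swap_mul_iff hd (hV ▸ hd)
    by_cases h0 : cyc (φ * rev) d₀ = cyc (φ * rev) a
    -- The two halves of the split vertex lie in different components, and every other vertex there
    -- is an old one with trivial holonomy. Induction applies to each half separately.
    · have Ta : TrivHol g (φ' * rev) a := by
        refine IH a (fun d hd hda => ?_) rfl
        have hd' : cyc (φ * rev) d ≠ cyc (φ * rev) a := by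
          rw [ne_eq, hmerge, not_or]
          exact ⟨hda, fun h => hC' (hd.symm.trans (hcc' h))⟩
        exact (hout hd').mpr (hd₀ d ((hcomp' hd).trans (hcc h0.symm)) (h0 ▸ hd'))
      have Tc : TrivHol g (φ' * rev) c := by
        refine IH c (fun d hd hda => ?_) rfl
        have hd' : cyc (φ * rev) d ≠ cyc (φ * rev) a := by
          rw [ne_eq, hmerge, not_or]
          exact ⟨fun h => hC' ((hcc' h).symm.trans hd), hda⟩
        exact (hout hd').mpr
          (hd₀ d ((hcomp' hd).trans (hcomp.symm.trans (hcc h0.symm))) (h0 ▸ hd'))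
      have := Ta.merge hV' Tc
      rw [← hrot'] at this
      exact this.congr h0.symm
    · refine (hout h0).mp (IH d₀ (fun d hd hdd => ?_) rfl)
      have hcyc0 : ∀ {x}, cyc (φ * rev) x = cyc (φ * rev) d₀ →
          cyc (φ' * rev) x = cyc (φ' * rev) d₀ := by
        intro x hx
        rw [hrot]
        exact (cyc_swap_mul_iff h0 (hV ▸ h0)).mpr hx
      -- If `d` is on one half of the split vertex, the other half lies in a component without `d₀`
      -- and is trivial by induction. The whole vertex is trivial by hypothesis, so the half of `d`
      -- is trivial as well.
      by_cases hda : cyc (φ * rev) d = cyc (φ * rev) a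
      · have Ta : TrivHol g (φ * rev) a :=
          hd₀ a ((hcc hda).symm.trans (hcomp' hd)) (Ne.symm h0)
        have hT : ∀ e, comp φ' rev e ≠ comp φ' rev d₀ → comp φ rev e = comp φ rev a →
            (∀ x, comp φ' rev x = comp φ' rev e → cyc (φ' * rev) x ≠ cyc (φ' * rev) e →
              cyc (φ * rev) x ≠ cyc (φ * rev) a) → TrivHol g (φ' * rev) e := by
          intro e he hea hx
          refine IH e (fun x hxe hxe' => (hout (hx x hxe hxe')).mpr ?_) rfl
          refine hd₀ x ((hcomp' hxe).trans (hea.trans ((hcc hda).symm.trans (hcomp' hd)))) ?_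
          exact fun h => he (hxe.symm.trans (hcc' (hcyc0 h)))
        rw [hrot'] at Ta
        rcases hmerge.mp hda with hda' | hda'
        · have Tc : TrivHol g (φ' * rev) c := by
            refine hT c (fun h => hC' ((hcc' hda').symm.trans (hd.trans h.symm))) hcomp.symm ?_
            intro x hx hx'
            rw [ne_eq, hmerge, not_or]
            exact ⟨fun h => hC' ((hcc' h).symm.trans hx), hx'⟩
          exact (Ta.of_merge_left hV' Tc).congr hda'.symm
        · have Ta' : TrivHol g (φ' * rev) a := by
            refine hT a (fun h => hC' (h.trans (hd.symm.trans (hcc' hda')))) rfl ?_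
            intro x hx hx'
            rw [ne_eq, hmerge, not_or]
            exact ⟨hx', fun h => hC' (hx.symm.trans (hcc' h))⟩
          exact (Ta.of_merge_right hV' Ta').congr hda'.symm
      · exact (hout hda).mpr (hd₀ d (hcomp' hd) fun h => hdd (hcyc0 h))
  · -- two vertices are merged
    have hmerge : ∀ {x}, cyc (φ' * rev) x = cyc (φ' * rev) a ↔
        cyc (φ * rev) x = cyc (φ * rev) a ∨ cyc (φ * rev) x = cyc (φ * rev) c := by
      intro x; rw [hrot]; exact cyc_merge_iff hV
    have hout : ∀ {d}, cyc (φ * rev) d ≠ cyc (φ * rev) a → cyc (φ * rev) d ≠ cyc (φ * rev) c →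
        (TrivHol g (φ' * rev) d ↔ TrivHol g (φ * rev) d) := by
      intro d hd hd'
      rw [hrot]
      exact trivHol_swap_mul_iff hd hd'
    -- When `d₀` is on one of the two merged vertices, the merged vertex is the only one in its
    -- component not known to be trivial. Dividing out the known factor then yields the vertex of
    -- `d₀`.
    have hT : comp φ rev d₀ = comp φ rev a →
        (cyc (φ * rev) d₀ = cyc (φ * rev) a ∨ cyc (φ * rev) d₀ = cyc (φ * rev) c) →
        TrivHol g (φ' * rev) a := by
      intro h00 h0
      refine IH a (fun d hd hda => ?_) rfl
      rw [ne_eq, hmerge, not_or] at hda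
      refine (hout hda.1 hda.2).mpr (hd₀ d ((hcomp' hd).trans h00.symm) ?_)
      rcases h0 with h0 | h0
      · exact h0 ▸ hda.1
      · exact h0 ▸ hda.2
    by_cases h0 : cyc (φ * rev) d₀ = cyc (φ * rev) a
    · have T := hT (hcc h0) (Or.inl h0)
      rw [hrot] at T
      refine (T.of_merge_left hV ?_).congr h0.symm
      exact hd₀ c (hcomp.symm.trans (hcc h0.symm)) (h0 ▸ Ne.symm hV)
    by_cases h0' : cyc (φ * rev) d₀ = cyc (φ * rev) c
    · have T := hT ((hcc h0').trans hcomp.symm) (Or.inr h0')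
      rw [hrot] at T
      refine (T.of_merge_right hV ?_).congr h0'.symm
      exact hd₀ a (hcomp.trans (hcc h0'.symm)) (h0' ▸ hV)
    refine (hout h0 h0').mp (IH d₀ (fun d hd hdd => ?_) rfl)
    by_cases hda : cyc (φ' * rev) d = cyc (φ' * rev) a
    · have hca : comp φ rev a = comp φ rev d₀ :=
        (hcomp' (hcc' hda)).symm.trans (hcomp' hd)
      have Ta := hd₀ a hca (Ne.symm h0)
      have Tc := hd₀ c (hcomp.symm.trans hca) (Ne.symm h0')
      have := Ta.merge hV Tc
      rw [← hrot] at this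
      exact this.congr hda.symm
    · rw [hmerge, not_or] at hda
      refine (hout hda.1 hda.2).mpr (hd₀ d (hcomp' hd) fun h => hdd ?_)
      rw [hrot]
      exact (cyc_swap_mul_iff h0 h0').mpr h

end Holonomy

end PlanarWeb

namespace PlanarWeb

/-! ### Matrices in `SU(3)` of trace `-1` and projections onto lines -/

section Matrices

open Matrix
open scoped ComplexOrder

/-- Cayley–Hamilton in dimension three with one factor `M` cancelled. For `M` in `SU(3)` the
adjugate is the conjugate transpose, so a prescribed trace determines a quadratic relation. -/
theorem adjugate_eq_of_fin_three {R : Type*} [CommRing R] (M : Matrix (Fin 3) (Fin 3) R) :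
    M.adjugate = M * M - M.trace • M + M.adjugate.trace • (1 : Matrix (Fin 3) (Fin 3) R) := by
  ext i j
  fin_cases i <;> fin_cases j <;>
    simp [adjugate_fin_three, mul_apply, trace, Fin.sum_univ_three, one_apply] <;> ring

/-- A matrix in `SU(3)` of trace `-1` is an involution. -/
theorem su_three_mul_self (M : specialUnitaryGroup (Fin 3) ℂ) (h : M.1.trace = -1) :
    M.1 * M.1 = 1 := by
  obtain ⟨M, hM⟩ := M
  obtain ⟨hU, hdet⟩ := mem_specialUnitaryGroup_iff.mp hM
  have h1 : Mᴴ * M = 1 := mem_unitaryGroup_iff'.mp hU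
  change M.trace = -1 at h
  change M * M = 1
  have hadj : M.adjugate = Mᴴ := by
    have h2 : M * M.adjugate = 1 := by rw [mul_adjugate, hdet, one_smul]
    rw [← one_mul M.adjugate, ← h1, mul_assoc, h2, mul_one]
  have h3 := adjugate_eq_of_fin_three M
  rw [hadj, trace_conjTranspose, h] at h3
  have h4 : M * M - 1 = Mᴴ - M := by
    rw [h3]
    simp
    abel
  -- For `N = M² - 1 = Mᴴ - M`, one has `Nᴴ = -N` and `N M = -N`. Thus `N² = N M² - N = 0`, so `Nᴴ N
  -- = 0` and `N = 0`.
  have h5 : (M * M - 1)ᴴ = -(M * M - 1) := by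
    rw [h4, conjTranspose_sub, conjTranspose_conjTranspose]
    abel
  have h6 : (M * M - 1) * M = -(M * M - 1) := by
    rw [show (M * M - 1) * M = (Mᴴ - M) * M by rw [h4], sub_mul, h1]
    abel
  have h7 : (M * M - 1)ᴴ * (M * M - 1) = 0 := by
    have h8 : (M * M - 1) * (M * M - 1) = ((M * M - 1) * M) * M - (M * M - 1) := by
      rw [mul_sub (M * M - 1) (M * M) 1, mul_one, ← mul_assoc]
    rw [h5, neg_mul, h8, h6, neg_mul, h6]
    abel
  exact sub_eq_zero.mp (conjTranspose_mul_self_eq_zero.mp h7)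

theorem su_three_isHermitian (M : specialUnitaryGroup (Fin 3) ℂ) (h : M.1.trace = -1) :
    M.1ᴴ = M.1 := by
  have h1 : M.1ᴴ * M.1 = 1 := mem_unitaryGroup_iff'.mp (mem_specialUnitaryGroup_iff.mp M.2).1
  rw [← mul_one M.1ᴴ, ← su_three_mul_self M h, ← mul_assoc, h1, one_mul]

/-- `P` is the orthogonal projection onto the line `x`. -/
structure IsLineProj (P : Matrix (Fin 3) (Fin 3) ℂ) (x : CP2) : Prop where
  conjTranspose_eq : Pᴴ = P
  mul_self : P * P = P
  mulVec_eq_iff : ∀ v : Fin 3 → ℂ, P *ᵥ v = v ↔ v ∈ x.submodule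

theorem eq_of_mem_submodule {x y : CP2} {v : Fin 3 → ℂ} (hv : v ≠ 0) (hx : v ∈ x.submodule)
    (hy : v ∈ y.submodule) : x = y := by
  have key : ∀ z : CP2, v ∈ z.submodule → Projectivization.mk ℂ v hv = z := by
    intro z hz
    rw [Projectivization.submodule_eq, Submodule.mem_span_singleton] at hz
    obtain ⟨a, ha⟩ := hz
    conv_rhs => rw [← z.mk_rep]
    exact (Projectivization.mk_eq_mk_iff' ℂ v z.rep hv z.rep_nonzero).mpr ⟨a, ha⟩
  rw [← key x hx, ← key y hy]

namespace IsLineProj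

variable {P Q : Matrix (Fin 3) (Fin 3) ℂ} {x y : CP2}

theorem mul_eq (hP : IsLineProj P x) (hQ : IsLineProj Q x) : P * Q = Q := by
  refine ext_of_mulVec_single fun i => ?_
  rw [← mulVec_mulVec, hP.mulVec_eq_iff, ← hQ.mulVec_eq_iff, mulVec_mulVec, hQ.mul_self]

/-- `P Q = Q` has adjoint `Q P = Q`, while `Q P = P` by symmetry. Hence a line determines its
projection, and so its meridian matrix. -/
theorem unique (hP : IsLineProj P x) (hQ : IsLineProj Q x) : P = Q := by
  have := congrArg conjTranspose (hP.mul_eq hQ)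
  rw [conjTranspose_mul, hP.conjTranspose_eq, hQ.conjTranspose_eq] at this
  rw [← this, hQ.mul_eq hP]

/-- Two lines agree if their projections fix a common nonzero matrix. -/
theorem eq_of_mul_eq {Y : Matrix (Fin 3) (Fin 3) ℂ} (hP : IsLineProj P x) (hQ : IsLineProj Q y)
    (hY : Y ≠ 0) (hPY : P * Y = Y) (hQY : Q * Y = Y) : x = y := by
  obtain ⟨i, hi⟩ : ∃ i, Y *ᵥ Pi.single i 1 ≠ 0 := by
    by_contra hc
    push Not at hc
    exact hY (ext_of_mulVec_single fun i => by rw [hc, zero_mulVec])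
  refine eq_of_mem_submodule hi ?_ ?_
  · rw [← hP.mulVec_eq_iff, mulVec_mulVec, hPY]
  · rw [← hQ.mulVec_eq_iff, mulVec_mulVec, hQY]

theorem ne_zero (hP : IsLineProj P x) : P ≠ 0 := by
  rintro rfl
  have := (hP.mulVec_eq_iff x.rep).mpr (by
    rw [Projectivization.submodule_eq]; exact Submodule.mem_span_singleton_self _)
  rw [zero_mulVec] at this
  exact x.rep_nonzero this.symm

end IsLineProj

theorem isLineProj_of_su_three (M : specialUnitaryGroup (Fin 3) ℂ) (h : M.1.trace = -1) {x : CP2}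
    (hx : ∀ v : Fin 3 → ℂ, M.1 *ᵥ v = v ↔ v ∈ x.submodule) :
    IsLineProj ((1 / 2 : ℂ) • (M.1 + 1)) x where
  conjTranspose_eq := by
    rw [conjTranspose_smul, conjTranspose_add, su_three_isHermitian M h, conjTranspose_one]
    simp
  mul_self := by
    rw [smul_mul_smul, add_mul, mul_add, su_three_mul_self M h]
    simp only [mul_one, one_mul]
    module
  mulVec_eq_iff v := by
    rw [← hx, smul_mulVec, add_mulVec, one_mulVec]
    constructor
    · intro hv
      linear_combination (norm := module) (2 : ℂ) • hv
    · intro hv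
      rw [hv]
      module

/-- Three matrices in `SU(3)` of trace `-1` with product `1` are the reflections in three pairwise
orthogonal lines. -/
theorem orthogonal_of_mul_eq_one {A B C : specialUnitaryGroup (Fin 3) ℂ} (hA : A.1.trace = -1)
    (hB : B.1.trace = -1) (hC : C.1.trace = -1) (h : A * B * C = 1)
    {P Q R : Matrix (Fin 3) (Fin 3) ℂ} (hP : P = (1 / 2 : ℂ) • (A.1 + 1))
    (hQ : Q = (1 / 2 : ℂ) • (B.1 + 1)) (hR : R = (1 / 2 : ℂ) • (C.1 + 1)) :
    P * Q = 0 ∧ Q * P = 0 ∧ P + Q + R = 1 := by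
  have h1 : A.1 * B.1 * C.1 = 1 := congrArg Subtype.val h
  have h2 : A.1 * B.1 = C.1 := by
    rw [← mul_one (A.1 * B.1), ← su_three_mul_self C hC, ← mul_assoc, h1, one_mul]
  -- Since `C` is its own inverse, `A B = C`, which makes the product `P Q` linear in the three
  -- matrices.
  have hPQ : P * Q = (1 / 2 : ℂ) • (P + Q + R - 1) := by
    rw [hP, hQ, hR, smul_mul_smul, add_mul, mul_add, h2]
    simp only [mul_one, one_mul]
    module
  have hPs : P * P = P := by
    rw [hP, smul_mul_smul, add_mul, mul_add, su_three_mul_self A hA]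
    simp only [mul_one, one_mul]
    module
  have hQs : Q * Q = Q := by
    rw [hQ, smul_mul_smul, add_mul, mul_add, su_three_mul_self B hB]
    simp only [mul_one, one_mul]
    module
  have hPh : Pᴴ = P := by
    rw [hP, conjTranspose_smul, conjTranspose_add, su_three_isHermitian A hA, conjTranspose_one]
    simp
  have hQh : Qᴴ = Q := by
    rw [hQ, conjTranspose_smul, conjTranspose_add, su_three_isHermitian B hB, conjTranspose_one]
    simp
  have htr : (P * Q).trace = 0 := by
    rw [hPQ, hP, hQ, hR]
    simp only [trace_smul, trace_sub, trace_add, hA, hB, hC, trace_one, Fintype.card_fin]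
    norm_num
  -- `tr ((P Q)ᴴ (P Q)) = tr (Q P Q) = tr (P Q) = 0`.
  have h0 : P * Q = 0 := by
    rw [← trace_conjTranspose_mul_self_eq_zero_iff, conjTranspose_mul, hPh, hQh, mul_assoc,
      ← mul_assoc P, hPs, trace_mul_comm, mul_assoc, hQs, htr]
  refine ⟨h0, ?_, ?_⟩
  · have := congrArg conjTranspose h0
    rwa [conjTranspose_mul, hPh, hQh, conjTranspose_zero] at this
  · rw [h0] at hPQ
    linear_combination (norm := module) (-2 : ℂ) • hPQ

/-! ### The one-parameter deformation of a reflection -/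

/-- The matrix with eigenvalue `b` on the range of the projection `P` and `a` on its kernel. -/
def blend (a b : ℂ) (P : Matrix (Fin 3) (Fin 3) ℂ) : Matrix (Fin 3) (Fin 3) ℂ :=
  a • (1 : Matrix (Fin 3) (Fin 3) ℂ) + (b - a) • P

theorem blend_mul_blend (a b c d : ℂ) (P Q : Matrix (Fin 3) (Fin 3) ℂ) :
    blend a b P * blend c d Q = (a * c) • (1 : Matrix (Fin 3) (Fin 3) ℂ) + ((b - a) * c) • P +
      (a * (d - c)) • Q + ((b - a) * (d - c)) • (P * Q) := by
  simp only [blend, add_mul, mul_add, smul_mul_smul, mul_one, one_mul]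
  abel

theorem blend_mul_self (a b c d : ℂ) {P : Matrix (Fin 3) (Fin 3) ℂ} (hP : P * P = P) :
    blend a b P * blend c d P = blend (a * c) (b * d) P := by
  rw [blend_mul_blend, hP, blend]
  module

/-- The matrix of determinant one with eigenvalues `r ^ 2` on the range of the projection `P` and
`r⁻¹` on its kernel. -/
def twist (r : ℂˣ) (P : {P : Matrix (Fin 3) (Fin 3) ℂ // P * P = P}) :
    (Matrix (Fin 3) (Fin 3) ℂ)ˣ where
  val := blend (r⁻¹ : ℂˣ) (r ^ 2 : ℂˣ) P.1
  inv := blend (r : ℂˣ) ((r⁻¹) ^ 2 : ℂˣ) P.1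
  val_inv := by
    rw [blend_mul_self _ _ _ _ P.2, ← Units.val_mul, ← Units.val_mul]
    simp [blend]
  inv_val := by
    rw [blend_mul_self _ _ _ _ P.2, ← Units.val_mul, ← Units.val_mul]
    simp [blend]

theorem twist_inv (r : ℂˣ) (P : {P : Matrix (Fin 3) (Fin 3) ℂ // P * P = P}) :
    (twist r P)⁻¹ = twist r⁻¹ P := by
  ext1
  simp [twist, Units.inv_mk]

/-- On each of the three ranges one factor acts by `r ^ 2` and the other two by `r⁻¹`. The reverse
orthogonality `Q P = 0` comes from expanding `R² = R` with `R = 1 - P - Q`. -/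
theorem twist_mul_twist_mul_twist (r : ℂˣ)
    {P Q R : {P : Matrix (Fin 3) (Fin 3) ℂ // P * P = P}} (hPQ : P.1 * Q.1 = 0)
    (h : P.1 + Q.1 + R.1 = 1) : twist r P * twist r Q * twist r R = 1 := by
  have hr : (r : ℂ) ≠ 0 := r.ne_zero
  have hR : R.1 = 1 - P.1 - Q.1 := by rw [← h]; abel
  have hRs := R.2
  have hPR : P.1 * R.1 = 0 := by rw [hR, mul_sub, mul_sub, mul_one, P.2, hPQ]; simp
  have hQR : Q.1 * R.1 = -(Q.1 * P.1) := by rw [hR, mul_sub, mul_sub, mul_one, Q.2]; abel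
  have hQP : Q.1 * P.1 = 0 := by
    rw [hR] at hRs
    have : (1 - P.1 - Q.1) * (1 - P.1 - Q.1) =
        1 - P.1 - Q.1 - P.1 - Q.1 + P.1 * P.1 + Q.1 * Q.1 + P.1 * Q.1 + Q.1 * P.1 := by
      noncomm_ring
    rw [this, P.2, Q.2, hPQ] at hRs
    linear_combination (norm := module) hRs
  rw [hQP, neg_zero] at hQR
  ext1
  simp only [Units.val_mul, Units.val_one]
  change blend _ _ _ * blend _ _ _ * blend _ _ _ = 1
  rw [blend_mul_blend, hPQ, blend]
  simp only [add_mul, mul_add, smul_mul_smul, one_mul, mul_one, hPR, hQR, smul_zero, add_zero]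
  rw [hR]
  simp only [Units.val_inv_eq_inv_val, Units.val_pow_eq_pow_val]
  match_scalars <;> field_simp <;> ring

/-- The relation satisfied by four lines at the boundary. -/
theorem eq_or_eq_of_twist {x : Fin 4 → CP2}
    {P : Fin 4 → {P : Matrix (Fin 3) (Fin 3) ℂ // P * P = P}} (hP : ∀ i, IsLineProj (P i).1 (x i))
    (h : ∀ r, twist r (P 0) * (twist r (P 1))⁻¹ * twist r (P 2) * (twist r (P 3))⁻¹ = 1) :
    (x 0 = x 1 ∧ x 2 = x 3) ∨ (x 0 = x 3 ∧ x 1 = x 2) := by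
  have h' : ∀ r, twist r (P 0) * (twist r (P 1))⁻¹ = twist r (P 3) * (twist r (P 2))⁻¹ := by
    intro r
    rw [eq_mul_inv_iff_mul_eq]
    exact mul_inv_eq_one.mp (h r)
  -- With `s = r ^ 3`, `twist r P₀ * (twist r P₁)⁻¹` equals `1 + (s - 1) / s • ((s - 1) • (P₀ -
  -- P₀P₁) + (P₀ - P₁))`. The inner bracket is affine in `s`, so two values of `s` other than `1`,
  -- here `8` and `27`, determine both coefficients.
  have h2 := congrArg Units.val (h' (Units.mk0 2 (by norm_num)))
  have h3 := congrArg Units.val (h' (Units.mk0 3 (by norm_num)))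
  change blend _ _ _ * blend _ _ _ = blend _ _ _ * blend _ _ _ at h2
  change blend _ _ _ * blend _ _ _ = blend _ _ _ * blend _ _ _ at h3
  rw [blend_mul_blend, blend_mul_blend] at h2 h3
  simp only [Units.val_inv_eq_inv_val, Units.val_pow_eq_pow_val, Units.val_mk0] at h2 h3
  obtain ⟨p, hp⟩ : ∃ p : Fin 4 → Matrix (Fin 3) (Fin 3) ℂ, ∀ i, (P i).1 = p i :=
    ⟨_, fun _ => rfl⟩
  simp only [hp] at h2 h3 hP
  have e1 : p 0 - p 0 * p 1 = p 3 - p 3 * p 2 := by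
    linear_combination (norm := module) (27 / (26 * 19) : ℂ) • h3 - (8 / (7 * 19) : ℂ) • h2
  have e2 : p 0 - p 1 = p 3 - p 2 := by
    linear_combination (norm := module) (8 / 7 : ℂ) • h2 - (7 : ℂ) • e1
  -- If `P₀ = P₀P₁`, the adjoint equation says that `P₁` fixes `P₀`. Otherwise `P₀(1 - P₁) = P₃(1 -
  -- P₂)` is a nonzero matrix fixed by both `P₀` and `P₃`.
  by_cases hY : p 0 - p 0 * p 1 = 0
  · have h01 : x 0 = x 1 := by
      refine (hP 0).eq_of_mul_eq (hP 1) (hP 0).ne_zero (hP 0).mul_self ?_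
      have := congrArg conjTranspose (sub_eq_zero.mp hY)
      rwa [conjTranspose_mul, (hP 0).conjTranspose_eq, (hP 1).conjTranspose_eq, eq_comm] at this
    refine Or.inl ⟨h01, ?_⟩
    have h1 := hP 1
    rw [← h01] at h1
    rw [(hP 0).unique h1, sub_self, eq_comm, sub_eq_zero] at e2
    refine (hP 2).eq_of_mul_eq (hP 3) (hP 2).ne_zero (hP 2).mul_self ?_
    rw [e2, (hP 2).mul_self]
  · have h03 : x 0 = x 3 := by
      refine (hP 0).eq_of_mul_eq (hP 3) hY ?_ ?_
      · rw [mul_sub, ← mul_assoc, (hP 0).mul_self]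
      · rw [e1, mul_sub, ← mul_assoc, (hP 3).mul_self]
    refine Or.inr ⟨h03, ?_⟩
    have h1 := hP 3
    rw [← h03] at h1
    rw [(hP 0).unique h1, sub_right_inj] at e2
    refine (hP 1).eq_of_mul_eq (hP 2) (hP 1).ne_zero (hP 1).mul_self ?_
    rw [e2, (hP 2).mul_self]

end Matrices

end PlanarWeb

namespace PlanarWeb

/-! ### The lines at the boundary of a planar web -/

namespace Web

variable {n : ℕ} (Γ : Web n)

theorem edge_rev (d : Γ.Dart) : Γ.edge (Γ.rev d) = Γ.edge d :=
  Eq.symm <| Quot.sound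
    (r := fun d d' : Γ.Dart => d' = Γ.rev d ∨ (Γ.IsMarked d ∧ d' = Γ.rot d)) (Or.inl rfl)

theorem edge_rot_of_isMarked {d : Γ.Dart} (hd : Γ.IsMarked d) : Γ.edge (Γ.rot d) = Γ.edge d :=
  Eq.symm <| Quot.sound
    (r := fun d d' : Γ.Dart => d' = Γ.rev d ∨ (Γ.IsMarked d ∧ d' = Γ.rot d)) (Or.inr ⟨hd, rfl⟩)

/-- A representation variety point, with the projections onto its lines. -/
theorem exists_proj {x : Γ.Edge → CP2} (hx : x ∈ Γ.repVariety) :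
    ∃ P : Γ.Edge → {P : Matrix (Fin 3) (Fin 3) ℂ // P * P = P},
      (∀ e, IsLineProj (P e).1 (x e)) ∧ ∀ d, Γ.IsTrivalent d → Γ.rot (Γ.rot (Γ.rot d)) = d →
        (P (Γ.edge d)).1 * (P (Γ.edge (Γ.rot d))).1 = 0 ∧
        (P (Γ.edge d)).1 + (P (Γ.edge (Γ.rot d))).1 + (P (Γ.edge (Γ.rot (Γ.rot d)))).1 = 1 := by
  obtain ⟨ρ, hρ⟩ := hx
  have hl := fun e => isLineProj_of_su_three (ρ (Γ.meridian e)) (hρ e).1 (hρ e).2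
  refine ⟨fun e => ⟨_, (hl e).mul_self⟩, hl, fun d hd hd3 => ?_⟩
  by_cases ho : Γ.out d
  · have h1 := PresentedGroup.one_of_mem (rels := Γ.relators) ⟨d, hd, Or.inr ⟨ho, rfl⟩⟩
    have h2 := congrArg ρ h1
    rw [map_mul, map_mul, map_mul, map_mul, map_one] at h2
    have h3 := orthogonal_of_mul_eq_one (hρ _).1 (hρ _).1 (hρ _).1 h2 rfl rfl rfl
    exact ⟨h3.1, h3.2.2⟩
  · have h1 := PresentedGroup.one_of_mem (rels := Γ.relators) ⟨d, hd, Or.inl ⟨ho, rfl⟩⟩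
    have h2 := congrArg ρ h1
    rw [map_mul, map_mul, map_mul, map_mul, map_one] at h2
    -- At a sink the relator is read in the opposite order; a cyclic rotation puts the first two
    -- edges in front.
    have h4 : ρ (Γ.meridian (Γ.edge (Γ.rot d))) * ρ (Γ.meridian (Γ.edge d)) *
        ρ (Γ.meridian (Γ.edge (Γ.rot (Γ.rot d)))) = 1 := by
      rw [mul_eq_one_iff_eq_inv', ← mul_eq_one_iff_eq_inv, ← mul_assoc]
      exact h2
    have h3 := orthogonal_of_mul_eq_one (hρ _).1 (hρ _).1 (hρ _).1 h4 rfl rfl rfl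
    refine ⟨h3.2.1, ?_⟩
    refine Eq.trans ?_ h3.2.2
    exact congrArg (· + _) (add_comm _ _)

open Classical in
/-- The label of a dart: the matrix of its edge, twisted, or the inverse of this matrix, according
to the orientation. -/
noncomputable def label (P : Γ.Edge → {P : Matrix (Fin 3) (Fin 3) ℂ // P * P = P}) (r : ℂˣ) (d : Γ.Dart) :
    (Matrix (Fin 3) (Fin 3) ℂ)ˣ :=
  if Γ.out d then twist r (P (Γ.edge d)) else twist r⁻¹ (P (Γ.edge d))

variable {P : Γ.Edge → {P : Matrix (Fin 3) (Fin 3) ℂ // P * P = P}} {r : ℂˣ}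

theorem label_rev (d : Γ.Dart) : Γ.label P r (Γ.rev d) = (Γ.label P r d)⁻¹ := by
  unfold label
  by_cases h : Γ.out d <;> simp [h, Γ.out_rev, edge_rev, twist_inv]

/-- The holonomy around the vertices in the interior is trivial. -/
theorem trivHol_interior
    (hP : ∀ d, Γ.IsTrivalent d → Γ.rot (Γ.rot (Γ.rot d)) = d →
        (P (Γ.edge d)).1 * (P (Γ.edge (Γ.rot d))).1 = 0 ∧
        (P (Γ.edge d)).1 + (P (Γ.edge (Γ.rot d))).1 + (P (Γ.edge (Γ.rot (Γ.rot d)))).1 = 1)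
    {d : Γ.Dart} (hd : d ∉ Set.range Γ.bdry) : TrivHol (Γ.label P r) Γ.rot d := by
  rcases Γ.interior d hd with ⟨h1, h2, h3⟩ | ⟨h1, h2, h3⟩
  -- At a marked point both darts lie on one edge, one pointing in and one out, so their labels
  -- cancel.
  · have hg : Γ.label P r d * Γ.label P r (Γ.rot d) = 1 := by
      rw [mul_eq_one_iff_eq_inv]
      unfold label
      rw [Γ.edge_rot_of_isMarked ⟨hd, h2⟩]
      by_cases h : Γ.out d <;> simp [h, h3, twist_inv]
    refine ⟨fun x => if x = d then 1 else Γ.label P r d, fun x hx => ?_⟩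
    have : x = d ∨ x = Γ.rot d := by
      refine mem_of_cyc_eq (p := fun x => x = d ∨ x = Γ.rot d) (fun y => ?_) hx.symm
        (Or.inl rfl)
      rw [Γ.rot.injective.eq_iff, or_comm]
      refine or_congr_right ⟨fun h => Γ.rot.injective (h.trans h2.symm), ?_⟩
      rintro rfl; exact h2
    rcases this with rfl | rfl
    · simp [h1]
    · simp [h1, h2, hg]
  · have h4 : Γ.rot (Γ.rot d) ≠ d := by
      intro h
      rw [h] at h2
      exact h1 h2
    have hg : Γ.label P r d * Γ.label P r (Γ.rot d) * Γ.label P r (Γ.rot (Γ.rot d)) = 1 := by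
      have ho2 : Γ.out (Γ.rot (Γ.rot d)) ↔ Γ.out d := by
        have hd1 : Γ.rot d ∉ Set.range Γ.bdry := by
          rintro ⟨j, hj⟩
          refine hd ⟨(finRotate n).symm j, Γ.rot.injective ?_⟩
          rw [Γ.rot_bdry, Equiv.apply_symm_apply, hj]
        rcases Γ.interior _ hd1 with ⟨-, h6, -⟩ | ⟨-, -, h6⟩
        · rw [h2] at h6
          exact (h1 h6.symm).elim
        · exact h6.trans h3
      obtain ⟨h5, h6⟩ := hP d ⟨hd, h4⟩ h2
      unfold label
      by_cases h : Γ.out d <;> simp only [h, h3, ho2, if_true, if_false] <;>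
        exact twist_mul_twist_mul_twist _ h5 h6
    refine ⟨fun x => if x = d then 1 else if x = Γ.rot d then Γ.label P r d else
      Γ.label P r d * Γ.label P r (Γ.rot d), fun x hx => ?_⟩
    have : x = d ∨ x = Γ.rot d ∨ x = Γ.rot (Γ.rot d) := by
      refine mem_of_cyc_eq (p := fun x => x = d ∨ x = Γ.rot d ∨ x = Γ.rot (Γ.rot d))
        (fun y => ?_) hx.symm (Or.inl rfl)
      rw [Γ.rot.injective.eq_iff, Γ.rot.injective.eq_iff]
      have : Γ.rot y = d ↔ y = Γ.rot (Γ.rot d) :=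
        ⟨fun h => Γ.rot.injective (h.trans h2.symm), by rintro rfl; exact h2⟩
      rw [this]
      tauto
    rcases this with rfl | rfl | rfl
    · simp [h1]
    · have : Γ.rot (Γ.rot d) ≠ Γ.rot d := fun h => h1 (Γ.rot.injective h)
      simp [h1, h4, this]
    · have : Γ.rot (Γ.rot d) ≠ Γ.rot d := fun h => h1 (Γ.rot.injective h)
      simp [h2, h4, this, hg]

/-- The lines at the boundary of a web with four boundary points agree in pairs. -/
theorem boundary_lines (Γ : Web 4) (hΓ : Γ.Alternating) {x : Γ.Edge → CP2}
    (hx : x ∈ Γ.repVariety) :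
    (x (Γ.edge (Γ.bdry 0)) = x (Γ.edge (Γ.bdry 1)) ∧
      x (Γ.edge (Γ.bdry 2)) = x (Γ.edge (Γ.bdry 3))) ∨
    (x (Γ.edge (Γ.bdry 0)) = x (Γ.edge (Γ.bdry 3)) ∧
      x (Γ.edge (Γ.bdry 1)) = x (Γ.edge (Γ.bdry 2))) := by
  obtain ⟨P, hP, hPv⟩ := Γ.exists_proj hx
  have hr := fun i => Γ.rot_bdry_four i
  have hrot : Γ.rot * Γ.rev * Γ.rev = Γ.rot := by
    ext d
    simp [Γ.rev_rev]
  -- This is the dual map: vertices and faces trade places, and Euler's formula is symmetric in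
  -- them.
  have hplan : EulerPlanar (Γ.rot * Γ.rev) Γ.rev := by
    have h := Γ.planar
    unfold EulerPlanar at h ⊢
    rw [hrot]
    have : numComponents (Γ.rot * Γ.rev) Γ.rev = numComponents Γ.rot Γ.rev := by
      have key : ∀ (π : Equiv.Perm Γ.Dart) (y : Γ.Dart),
          Quot.mk (fun x y => y = π x ∨ y = Γ.rev x) (Γ.rev y) = Quot.mk _ y :=
        fun π y => Eq.symm <| Quot.sound
            (r := fun x y => y = π x ∨ y = Γ.rev x) (Or.inr rfl)
      have key' : ∀ (π : Equiv.Perm Γ.Dart) (y : Γ.Dart),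
          Quot.mk (fun x y => y = π x ∨ y = Γ.rev x) (π y) = Quot.mk _ y :=
        fun π y => Eq.symm <| Quot.sound
            (r := fun x y => y = π x ∨ y = Γ.rev x) (Or.inl rfl)
      refine numClasses_congr ?_ ?_
      · rintro y _ (rfl | rfl)
        · rw [Equiv.Perm.mul_apply, key', key]
        · rw [key]
      · rintro y _ (rfl | rfl)
        · have := key' (Γ.rot * Γ.rev) (Γ.rev y)
          rw [Equiv.Perm.mul_apply, Γ.rev_rev, key] at this
          exact this.symm
        · rw [key]
    rw [this]
    omega
  have hcyc : ∀ i, cyc Γ.rot (Γ.bdry i) = cyc Γ.rot (Γ.bdry 0) := by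
    have h1 := fun i => hr i ▸ cyc_apply Γ.rot (Γ.bdry i)
    intro i
    fin_cases i
    · rfl
    · exact h1 0
    · exact (h1 1).trans (h1 0)
    · exact (h1 2).trans ((h1 1).trans (h1 0))
  have hol : ∀ r, Γ.label P r (Γ.bdry 0) * Γ.label P r (Γ.bdry 1) * Γ.label P r (Γ.bdry 2) *
      Γ.label P r (Γ.bdry 3) = 1 := by
    intro r
    have hT : TrivHol (Γ.label P r) (Γ.rot * Γ.rev * Γ.rev) (Γ.bdry 0) := by
      refine trivHol_of_planar Γ.rev_rev Γ.rev_ne Γ.label_rev _ hplan _ fun d _ hd => ?_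
      rw [hrot] at hd ⊢
      refine Γ.trivHol_interior hPv ?_
      rintro ⟨i, rfl⟩
      exact hd (hcyc i)
    rw [hrot] at hT
    obtain ⟨m, hm⟩ := hT
    have h := fun i => hm _ (hcyc i)
    simp only [hr] at h
    have h0 := h 0
    have h1 := h 1
    have h2 := h 2
    have h3 := h 3
    simp only [show (0 : Fin 4) + 1 = 1 from rfl, show (1 : Fin 4) + 1 = 2 from rfl,
      show (2 : Fin 4) + 1 = 3 from rfl, show (3 : Fin 4) + 1 = 0 from rfl] at h0 h1 h2 h3
    rw [h2, h1, h0, mul_assoc, mul_assoc, mul_assoc] at h3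
    rw [mul_assoc, mul_assoc]
    exact left_eq_mul.mp h3
  have a0 := hΓ 0
  have a1 := hΓ 1
  have a2 := hΓ 2
  simp only [show (0 : Fin 4) + 1 = 1 from rfl, show (1 : Fin 4) + 1 = 2 from rfl,
      show (2 : Fin 4) + 1 = 3 from rfl] at a0 a1 a2
  refine eq_or_eq_of_twist (x := fun i => x (Γ.edge (Γ.bdry i)))
    (P := fun i => P (Γ.edge (Γ.bdry i))) (fun i => hP _) fun r => ?_
  -- If the signs start with `-`, all exponents are inverted; replacing `r` by `r⁻¹` restores the
  -- same relation.
  by_cases h : Γ.out (Γ.bdry 0)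
  · simpa [label, a0, a1, a2, h, twist_inv] using hol r
  · simpa [label, a0, a1, a2, h, twist_inv] using hol r⁻¹

end Web

/-! ### The real Zariski topology -/

section Zariski

variable {E F : Type}

theorem exists_represents (x : E → CP2) : ∃ z, Represents z x :=
  ⟨fun e => (x e).rep, fun e => ⟨(x e).rep_nonzero, (x e).mk_rep⟩⟩

/-- Pulling back families of lines along a map of index sets is continuous. -/
theorem continuous_comp_zariski (σ : F → E) :
    @Continuous _ _ (zariski E) (zariski F) fun x : E → CP2 => x ∘ σ := by
  let _ := zariski E
  refine continuous_generateFrom_iff.mpr ?_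
  rintro _ ⟨p, rfl⟩
  rw [isOpen_iff_forall_mem_open]
  rintro x ⟨z, hz, hp⟩
  obtain ⟨w, hw⟩ := exists_represents x
  -- Polynomials need not be homogeneous, so the choice of coordinates matters: two indices `f` with
  -- the same image may carry different multiples of one vector. These scalars are absorbed into the
  -- coefficients of `q`.
  have hl : ∀ f, ∃ a : ℂ, a ≠ 0 ∧ z f = a • w (σ f) := by
    intro f
    obtain ⟨h1, h2⟩ := hz f
    obtain ⟨h3, h4⟩ := hw (σ f)
    obtain ⟨a, ha⟩ := (Projectivization.mk_eq_mk_iff' ℂ _ _ h1 h3).mp (h2.trans h4.symm)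
    refine ⟨a, ?_, ha.symm⟩
    rintro rfl
    exact h1 (by rw [← ha, zero_smul])
  choose a ha0 ha using hl
  let q : MvPolynomial ((E × Fin 3) ⊕ (E × Fin 3)) ℂ := MvPolynomial.bind₁
    (Sum.elim (fun k : F × Fin 3 => MvPolynomial.C (a k.1) * MvPolynomial.X (Sum.inl (σ k.1, k.2)))
      fun k => MvPolynomial.C (starRingEnd ℂ (a k.1)) * MvPolynomial.X (Sum.inr (σ k.1, k.2))) p
  have hq : ∀ v : E → Fin 3 → ℂ,
      q.eval (Sum.elim (fun k => v k.1 k.2) fun k => starRingEnd ℂ (v k.1 k.2)) =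
      p.eval (Sum.elim (fun k => (a k.1 • v (σ k.1)) k.2)
        fun k => starRingEnd ℂ ((a k.1 • v (σ k.1)) k.2)) := by
    intro v
    have h1 := MvPolynomial.eval₂Hom_bind₁ (RingHom.id ℂ)
      (Sum.elim (fun k => v k.1 k.2) fun k => starRingEnd ℂ (v k.1 k.2))
      (Sum.elim (fun k : F × Fin 3 =>
          MvPolynomial.C (a k.1) * MvPolynomial.X (Sum.inl (σ k.1, k.2)))
        fun k => MvPolynomial.C (starRingEnd ℂ (a k.1)) * MvPolynomial.X (Sum.inr (σ k.1, k.2))) p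
    refine h1.trans ?_
    change MvPolynomial.eval _ p = _
    congr 2
    funext k
    rcases k with k | k <;> simp
  refine ⟨{y | ∃ v, Represents v y ∧
    q.eval (Sum.elim (fun k => v k.1 k.2) fun k => starRingEnd ℂ (v k.1 k.2)) ≠ 0}, ?_,
    TopologicalSpace.isOpen_generateFrom_of_mem ⟨q, rfl⟩, ⟨w, hw, ?_⟩⟩
  · rintro y ⟨v, hv, hvq⟩
    refine ⟨fun f => a f • v (σ f), fun f => ?_, by rwa [hq] at hvq⟩
    obtain ⟨h1, h2⟩ := hv (σ f)
    exact ⟨smul_ne_zero (ha0 f) h1,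
      ((Projectivization.mk_eq_mk_iff' ℂ _ _ _ h1).mpr ⟨a f, rfl⟩).trans h2⟩
  · rw [hq]
    have : (fun f => a f • w (σ f)) = z := funext fun f => (ha f).symm
    simp only [← ha]
    exact hp

/-- Nonzero vectors are proportional iff their `2 × 2` minors vanish. -/
theorem mk_eq_mk_iff_minors {v w : Fin 3 → ℂ} (hv : v ≠ 0) (hw : w ≠ 0) :
    Projectivization.mk ℂ v hv = Projectivization.mk ℂ w hw ↔
      ∀ i j, v i * w j - v j * w i = 0 := by
  rw [Projectivization.mk_eq_mk_iff']
  constructor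
  · rintro ⟨a, rfl⟩ i j
    simp only [Pi.smul_apply, smul_eq_mul]
    ring
  · intro h
    obtain ⟨j, hj⟩ := Function.ne_iff.mp hw
    refine ⟨v j / w j, funext fun i => ?_⟩
    have hj' : w j ≠ 0 := hj
    simp only [Pi.smul_apply, smul_eq_mul]
    field_simp
    linear_combination -h i j

/-- Lines differ iff some `2 × 2` minor of their coordinates is nonzero, so the complement is a
finite union of basic open sets. -/
theorem isClosed_eq_zariski (e e' : E) : @IsClosed _ (zariski E) {x : E → CP2 | x e = x e'} := by
  let _ := zariski E
  rw [← isOpen_compl_iff]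
  have : {x : E → CP2 | x e = x e'}ᶜ = ⋃ i : Fin 3, ⋃ j : Fin 3,
      {x | ∃ z, Represents z x ∧ (MvPolynomial.X (Sum.inl (e, i)) * MvPolynomial.X (Sum.inl (e', j))
        - MvPolynomial.X (Sum.inl (e, j)) * MvPolynomial.X (Sum.inl (e', i)) :
          MvPolynomial ((E × Fin 3) ⊕ (E × Fin 3)) ℂ).eval
        (Sum.elim (fun k => z k.1 k.2) fun k => starRingEnd ℂ (z k.1 k.2)) ≠ 0} := by
    ext x
    have key : ∀ z, Represents z x →
        (x e = x e' ↔ ∀ i j, z e i * z e' j - z e j * z e' i = 0) := by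
      intro z hz
      obtain ⟨h1, h2⟩ := hz e
      obtain ⟨h3, h4⟩ := hz e'
      rw [← h2, ← h4, mk_eq_mk_iff_minors]
    simp only [Set.mem_compl_iff, Set.mem_ofPred_eq, Set.mem_iUnion, map_sub, map_mul,
      MvPolynomial.eval_X, Sum.elim_inl]
    constructor
    · intro hx
      obtain ⟨z, hz⟩ := exists_represents x
      rw [key z hz] at hx
      push Not at hx
      obtain ⟨i, j, hij⟩ := hx
      exact ⟨i, j, z, hz, hij⟩
    · rintro ⟨i, j, z, hz, hij⟩ hx
      exact hij ((key z hz).mp hx i j)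
  rw [this]
  exact isOpen_iUnion fun i => isOpen_iUnion fun j =>
    TopologicalSpace.isOpen_generateFrom_of_mem ⟨_, rfl⟩

/-- Pulling back families of lines along a map of index sets is smooth. -/
theorem smoothOn_comp [Fintype E] [Fintype F] (σ : F → E) (S : Set (E → CP2)) :
    SmoothOn (fun x => x ∘ σ) S := by
  intro x _ z _
  refine ⟨Set.univ, isOpen_univ, Set.mem_univ _, fun w => w ∘ σ, ?_, ?_⟩
  · refine ContDiff.contDiffOn (contDiff_pi.mpr fun f => ?_)
    exact contDiff_apply ℝ (Fin 3 → ℂ) (σ f)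
  · exact fun w _ y _ hw f => hw (σ f)

end Zariski

/-! ### Components of the representation varieties -/

namespace Web

variable {Γ : Web 4} {hΓ : Γ.Alternating} {i : Fin 4}

theorem toCloseUp_surjective : Function.Surjective (Γ.toCloseUp hΓ i) := by
  rintro ⟨d⟩
  exact ⟨Γ.edge d, rfl⟩

/-- Closing up turns the boundary darts into marked points and leaves the rotation elsewhere
untouched, so no Wirtinger relator is gained or lost. -/
theorem isTrivalent_closeUp_iff {d : Γ.Dart} :
    (Γ.closeUp hΓ i).IsTrivalent d ↔ Γ.IsTrivalent d := by
  have hrange : d ∉ Set.range (Γ.closeUp hΓ i).bdry := fun h => h.choose.elim0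
  by_cases hd : d ∈ Set.range Γ.bdry
  · refine iff_of_false (fun h => h.2 ?_) fun h => h.1 hd
    obtain ⟨j, rfl⟩ := hd
    obtain ⟨h0, h1, h2, h3⟩ := Γ.closeRot_bdry i
    have hj : j = i ∨ j = i + 1 ∨ j = i + 2 ∨ j = i + 3 := by
      clear * -
      revert i j; decide
    change Γ.closeRot i (Γ.closeRot i _) = _
    rcases hj with rfl | rfl | rfl | rfl
    · rw [h0, h1]
    · rw [h1, h0]
    · rw [h2, h3]
    · rw [h3, h2]
  · have e1 := Γ.closeRot_of_notMem i hd
    have e2 := Γ.closeRot_of_notMem i (Γ.rot_notMem_bdry hd)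
    refine and_congr (iff_of_true hrange hd) (not_congr ?_)
    change Γ.closeRot i (Γ.closeRot i d) = d ↔ _
    rw [e1, e2]

/-- The relators of the closed web are the images of the relators of the web. -/
theorem relators_closeUp :
    (Γ.closeUp hΓ i).relators = FreeGroup.map (Γ.toCloseUp hΓ i) '' Γ.relators := by
  have hrot : ∀ d, Γ.IsTrivalent d → Γ.closeRot i d = Γ.rot d ∧
      Γ.closeRot i (Γ.rot d) = Γ.rot (Γ.rot d) := fun d hd =>
    ⟨Γ.closeRot_of_notMem i hd.1, Γ.closeRot_of_notMem i (Γ.rot_notMem_bdry hd.1)⟩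
  ext w
  constructor
  · rintro ⟨d, hd, h⟩
    have hd' := isTrivalent_closeUp_iff.mp hd
    change (¬ Γ.out d ∧ w = FreeGroup.of (Γ.toCloseUp hΓ i (Γ.edge
        (Γ.closeRot i (Γ.closeRot i d)))) * FreeGroup.of (Γ.toCloseUp hΓ i (Γ.edge
        (Γ.closeRot i d))) * FreeGroup.of (Γ.toCloseUp hΓ i (Γ.edge d))) ∨
      (Γ.out d ∧ w = FreeGroup.of (Γ.toCloseUp hΓ i (Γ.edge d)) *
        FreeGroup.of (Γ.toCloseUp hΓ i (Γ.edge (Γ.closeRot i d))) *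
        FreeGroup.of (Γ.toCloseUp hΓ i (Γ.edge (Γ.closeRot i (Γ.closeRot i d))))) at h
    rw [(hrot d hd').1, (hrot d hd').2] at h
    rcases h with ⟨ho, rfl⟩ | ⟨ho, rfl⟩
    · exact ⟨_, ⟨d, hd', Or.inl ⟨ho, rfl⟩⟩, by simp⟩
    · exact ⟨_, ⟨d, hd', Or.inr ⟨ho, rfl⟩⟩, by simp⟩
  · rintro ⟨_, ⟨d, hd, h⟩, rfl⟩
    refine ⟨d, isTrivalent_closeUp_iff.mpr hd, ?_⟩
    change (¬ Γ.out d ∧ _ = FreeGroup.of (Γ.toCloseUp hΓ i (Γ.edge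
        (Γ.closeRot i (Γ.closeRot i d)))) * FreeGroup.of (Γ.toCloseUp hΓ i (Γ.edge
        (Γ.closeRot i d))) * FreeGroup.of (Γ.toCloseUp hΓ i (Γ.edge d))) ∨
      (Γ.out d ∧ _ = FreeGroup.of (Γ.toCloseUp hΓ i (Γ.edge d)) *
        FreeGroup.of (Γ.toCloseUp hΓ i (Γ.edge (Γ.closeRot i d))) *
        FreeGroup.of (Γ.toCloseUp hΓ i (Γ.edge (Γ.closeRot i (Γ.closeRot i d)))))
    rw [(hrot d hd).1, (hrot d hd).2]
    rcases h with ⟨ho, rfl⟩ | ⟨ho, rfl⟩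
    · exact Or.inl ⟨ho, by simp⟩
    · exact Or.inr ⟨ho, by simp⟩

/-- Representations of the closed web are representations of the web that assign the same line to
edges contained in one edge of the closed web. -/
theorem comp_toCloseUp_mem_repVariety {y : (Γ.closeUp hΓ i).Edge → CP2} :
    y ∘ Γ.toCloseUp hΓ i ∈ Γ.repVariety ↔ y ∈ (Γ.closeUp hΓ i).repVariety := by
  constructor
  · rintro ⟨ρ, hρ⟩
    obtain ⟨σ, hσ⟩ := (toCloseUp_surjective (hΓ := hΓ) (i := i)).hasRightInverse
    let M : (Γ.closeUp hΓ i).Edge → Matrix.specialUnitaryGroup (Fin 3) ℂ :=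
      fun e => ρ (Γ.meridian (σ e))
    -- The choice of `σ` is harmless: edges of `Γ` inside one closed edge carry the same line, and
    -- the line determines the matrix.
    have hM : ∀ e, M (Γ.toCloseUp hΓ i e) = ρ (Γ.meridian e) := by
      intro e
      have h1 := isLineProj_of_su_three _ (hρ (σ (Γ.toCloseUp hΓ i e))).1
        (hρ (σ (Γ.toCloseUp hΓ i e))).2
      have h2 := isLineProj_of_su_three _ (hρ e).1 (hρ e).2
      rw [Function.comp_apply, hσ] at h1
      have h3 := smul_right_injective _ (by norm_num : (1 / 2 : ℂ) ≠ 0) (h1.unique h2)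
      exact Subtype.ext (add_right_cancel h3)
    have hrel : ∀ w ∈ (Γ.closeUp hΓ i).relators, FreeGroup.lift M w = 1 := by
      rw [relators_closeUp]
      rintro _ ⟨w, hw, rfl⟩
      have h1 : (FreeGroup.lift M).comp (FreeGroup.map (Γ.toCloseUp hΓ i)) =
          ρ.comp (PresentedGroup.mk Γ.relators) := by
        ext1 e
        simp only [MonoidHom.comp_apply, FreeGroup.map.of, FreeGroup.lift_apply_of, hM]
        rfl
      have h2 := DFunLike.congr_fun h1 w
      rw [MonoidHom.comp_apply, MonoidHom.comp_apply, PresentedGroup.one_of_mem hw,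
        map_one] at h2
      exact h2
    refine ⟨PresentedGroup.toGroup hrel, fun e => ?_⟩
    obtain ⟨e, rfl⟩ := toCloseUp_surjective e
    have : PresentedGroup.toGroup hrel ((Γ.closeUp hΓ i).meridian (Γ.toCloseUp hΓ i e)) =
        ρ (Γ.meridian e) := (PresentedGroup.toGroup.of hrel).trans (hM e)
    rw [this]
    exact hρ e
  · rintro ⟨ρ, hρ⟩
    have hrel : ∀ w ∈ Γ.relators, FreeGroup.lift
        (fun e => ρ ((Γ.closeUp hΓ i).meridian (Γ.toCloseUp hΓ i e))) w = 1 := by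
      intro w hw
      have h1 : FreeGroup.lift
          (fun e => ρ ((Γ.closeUp hΓ i).meridian (Γ.toCloseUp hΓ i e))) =
          (ρ.comp (PresentedGroup.mk (Γ.closeUp hΓ i).relators)).comp
            (FreeGroup.map (Γ.toCloseUp hΓ i)) := by
        ext1 e
        simp only [MonoidHom.comp_apply, FreeGroup.map.of, FreeGroup.lift_apply_of]
        rfl
      have hw' : FreeGroup.map (Γ.toCloseUp hΓ i) w ∈ (Γ.closeUp hΓ i).relators := by
        rw [relators_closeUp]
        exact ⟨w, hw, rfl⟩
      rw [h1, MonoidHom.comp_apply, MonoidHom.comp_apply, PresentedGroup.one_of_mem hw', map_one]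
    refine ⟨PresentedGroup.toGroup hrel, fun e => ?_⟩
    have : PresentedGroup.toGroup hrel (Γ.meridian e) = _ := PresentedGroup.toGroup.of hrel
    rw [this]
    exact hρ _

/-- A family of lines that agrees at the boundary points to be joined comes from a family of lines
on the closed web. -/
theorem eq_of_toCloseUp_eq {x : Γ.Edge → CP2}
    (h₁ : x (Γ.edge (Γ.bdry i)) = x (Γ.edge (Γ.bdry (i + 1))))
    (h₂ : x (Γ.edge (Γ.bdry (i + 2))) = x (Γ.edge (Γ.bdry (i + 3)))) {e e' : Γ.Edge}
    (he : Γ.toCloseUp hΓ i e = Γ.toCloseUp hΓ i e') : x e = x e' := by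
  obtain ⟨d, rfl⟩ := Quot.exists_rep e
  obtain ⟨d', rfl⟩ := Quot.exists_rep e'
  refine congrArg (Quot.lift (fun d => x (Γ.edge d)) ?_) he
  change ∀ a b : Γ.Dart, _ → x (Γ.edge a) = x (Γ.edge b)
  rintro d d' (hd | ⟨⟨-, hd⟩, hd'⟩)
  · subst hd
    exact congrArg x (Γ.edge_rev d).symm
  · change Γ.closeRot i (Γ.closeRot i d) = d at hd
    change d' = Γ.closeRot i d at hd'
    subst hd'
    by_cases hb : d ∈ Set.range Γ.bdry
    · obtain ⟨j, rfl⟩ := hb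
      obtain ⟨e0, e1, e2, e3⟩ := Γ.closeRot_bdry i
      have hj : j = i ∨ j = i + 1 ∨ j = i + 2 ∨ j = i + 3 := by
        clear * -
        revert i j; decide
      rcases hj with rfl | rfl | rfl | rfl
      · rw [e0, h₁]
      · rw [e1, h₁]
      · rw [e2, h₂]
      · rw [e3, h₂]
    · rw [Γ.closeRot_of_notMem i hb] at hd ⊢
      rw [Γ.closeRot_of_notMem i (Γ.rot_notMem_bdry hb)] at hd
      rw [Γ.edge_rot_of_isMarked ⟨hb, hd⟩]

/-- A component of `R(Γ)` on which the lines agree at the boundary points to be joined is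
diffeomorphic to a component of the representation variety of the closed web. -/
theorem exists_component_closeUp {C : Set (Γ.Edge → CP2)} (hC : C ∈ Γ.components)
    (h : ∀ x ∈ C, x (Γ.edge (Γ.bdry i)) = x (Γ.edge (Γ.bdry (i + 1))) ∧
      x (Γ.edge (Γ.bdry (i + 2))) = x (Γ.edge (Γ.bdry (i + 3)))) :
    ∃ C' ∈ (Γ.closeUp hΓ i).components, ∃ Φ, IsDiffeoOn Φ C C' ∧
      ∀ x ∈ C, ∀ e, Φ x (Γ.toCloseUp hΓ i e) = x e := by
  obtain ⟨σ, hσ⟩ := (toCloseUp_surjective (hΓ := hΓ) (i := i)).hasRightInverse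
  have hx : ∀ x ∈ C, (x ∘ σ) ∘ Γ.toCloseUp hΓ i = x := fun x hx =>
    funext fun e => eq_of_toCloseUp_eq (h x hx).1 (h x hx).2 (hσ _)
  have hy : ∀ y : (Γ.closeUp hΓ i).Edge → CP2, (y ∘ Γ.toCloseUp hΓ i) ∘ σ = y :=
    fun y => funext fun e => congrArg y (hσ e)
  obtain ⟨⟨hCR, hCi⟩, hmax⟩ := hC
  let _ := zariski Γ.Edge
  let _ := zariski (Γ.closeUp hΓ i).Edge
  -- Restriction along a section `σ` of the edge map inverts pullback on `C`, because the lines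
  -- there are constant on the fibres of the edge map.
  refine ⟨(fun x => x ∘ σ) '' C, ⟨⟨?_, ?_⟩, ?_⟩, fun x => x ∘ σ,
    ⟨Set.mapsTo_image _ _, smoothOn_comp σ C, fun y => y ∘ Γ.toCloseUp hΓ i, ?_,
      smoothOn_comp _ _, hx, fun y _ => hy y⟩, fun x hxC e => congrFun (hx x hxC) e⟩
  · rintro _ ⟨x, hxC, rfl⟩
    rw [← comp_toCloseUp_mem_repVariety, hx x hxC]
    exact hCR hxC
  · exact hCi.image _ (continuous_comp_zariski σ).continuousOn
  · rintro s ⟨hsR, hsi⟩ hCs y hys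
    -- A larger irreducible `s` pulls back to an irreducible subset of `R(Γ)` containing `C`, which
    -- maximality of `C` forces back into `C`.
    have hle : C ≤ (fun y => y ∘ Γ.toCloseUp hΓ i) '' s :=
      fun x hxC => ⟨x ∘ σ, hCs ⟨x, hxC, rfl⟩, hx x hxC⟩
    have hs := hmax ⟨?_, hsi.image _ (continuous_comp_zariski _).continuousOn⟩ hle
    · exact ⟨_, hs ⟨y, hys, rfl⟩, hy y⟩
    · rintro _ ⟨y, hys, rfl⟩
      exact comp_toCloseUp_mem_repVariety.mpr (hsR hys)
  · rintro _ ⟨x, hxC, rfl⟩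
    change (x ∘ σ) ∘ Γ.toCloseUp hΓ i ∈ C
    rwa [hx x hxC]

theorem evBoundary_mem_diagV {x : Γ.Edge → CP2} : Γ.evBoundary x ∈ diagV ↔
    x (Γ.edge (Γ.bdry 0)) = x (Γ.edge (Γ.bdry 1)) ∧
      x (Γ.edge (Γ.bdry 2)) = x (Γ.edge (Γ.bdry 3)) := by
  constructor
  · rintro ⟨u, v, h⟩
    have := fun j => congrFun h j
    exact ⟨(this 0).trans (this 1).symm, (this 2).trans (this 3).symm⟩
  · rintro ⟨h1, h2⟩
    refine ⟨x (Γ.edge (Γ.bdry 0)), x (Γ.edge (Γ.bdry 2)), funext fun j => ?_⟩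
    fin_cases j
    exacts [rfl, h1.symm, rfl, h2.symm]

theorem evBoundary_mem_diagH {x : Γ.Edge → CP2} : Γ.evBoundary x ∈ diagH ↔
    x (Γ.edge (Γ.bdry 0)) = x (Γ.edge (Γ.bdry 3)) ∧
      x (Γ.edge (Γ.bdry 1)) = x (Γ.edge (Γ.bdry 2)) := by
  constructor
  · rintro ⟨u, v, h⟩
    have := fun j => congrFun h j
    exact ⟨(this 0).trans (this 3).symm, (this 1).trans (this 2).symm⟩
  · rintro ⟨h1, h2⟩
    refine ⟨x (Γ.edge (Γ.bdry 0)), x (Γ.edge (Γ.bdry 1)), funext fun j => ?_⟩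
    fin_cases j
    exacts [rfl, rfl, h2.symm, h1.symm]

/-- The pointwise dichotomy covers the component by two closed sets; irreducibility makes the choice
uniform. -/
theorem evBoundary_component (hΓ : Γ.Alternating) {C : Set (Γ.Edge → CP2)}
    (hC : C ∈ Γ.components) : Γ.evBoundary '' C ⊆ diagV ∨ Γ.evBoundary '' C ⊆ diagH := by
  let _ := zariski Γ.Edge
  have hV : IsClosed {x | Γ.evBoundary x ∈ diagV} := by
    simp only [evBoundary_mem_diagV]
    exact (isClosed_eq_zariski _ _).inter (isClosed_eq_zariski _ _)
  have hH : IsClosed {x | Γ.evBoundary x ∈ diagH} := by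
    simp only [evBoundary_mem_diagH]
    exact (isClosed_eq_zariski _ _).inter (isClosed_eq_zariski _ _)
  have hsub : C ⊆ {x | Γ.evBoundary x ∈ diagV} ∪ {x | Γ.evBoundary x ∈ diagH} := by
    intro x hx
    rcases Γ.boundary_lines hΓ (hC.1.1 hx) with h | h
    · exact Or.inl (evBoundary_mem_diagV.mpr h)
    · exact Or.inr (evBoundary_mem_diagH.mpr h)
  simp only [Set.image_subset_iff]
  exact isPreirreducible_iff_isClosed_union_isClosed.mp hC.1.2.2 _ _ hV hH hsub

end Web

end PlanarWeb

theorem mainTheorem3 (Γ : PlanarWeb.Web 4) (hΓ : Γ.Alternating)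
    (C : Set (Γ.Edge → PlanarWeb.CP2)) (hC : C ∈ Γ.components) :
    (Γ.evBoundary '' C ⊆ PlanarWeb.diagV ∨ Γ.evBoundary '' C ⊆ PlanarWeb.diagH) ∧
    (Γ.evBoundary '' C ⊆ PlanarWeb.diagV →
      ∃ C' ∈ (Γ.closeV hΓ).components, ∃ Φ, PlanarWeb.IsDiffeoOn Φ C C' ∧
        ∀ x ∈ C, ∀ e, Φ x (Γ.toCloseV hΓ e) = x e) ∧
    (Γ.evBoundary '' C ⊆ PlanarWeb.diagH →
      ∃ C' ∈ (Γ.closeH hΓ).components, ∃ Φ, PlanarWeb.IsDiffeoOn Φ C C' ∧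
        ∀ x ∈ C, ∀ e, Φ x (Γ.toCloseH hΓ e) = x e) := by
  refine ⟨PlanarWeb.Web.evBoundary_component hΓ hC, fun h => ?_, fun h => ?_⟩
  · refine PlanarWeb.Web.exists_component_closeUp (i := 0) hC fun x hx => ?_
    exact PlanarWeb.Web.evBoundary_mem_diagV.mp (h ⟨x, hx, rfl⟩)
  · refine PlanarWeb.Web.exists_component_closeUp (i := 1) hC fun x hx => ?_
    have := PlanarWeb.Web.evBoundary_mem_diagH.mp (h ⟨x, hx, rfl⟩)
    -- For `i = 1` the second pair is `i + 2 = 3`, `i + 3 = 0` in `Fin 4`, which reverses the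
    -- equality.
    exact ⟨this.2, this.1.symm⟩
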